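/- Let $n,N\ge 1$ be integers, let $K>n+N$, and let $n_0$ be the smallest integer with $n_0>n/2$. Let $\eta:\mathbb R^n\to\mathbb C$ be of class $C^{n_0}$ such that for every multi-index $\beta$ with $0\le|\beta|\le n_0$ there is a constant $C_\beta$ with $(1+|x|)^K|\partial^\beta\eta(x)|\le C_\beta$ for all $x\in\mathbb R^n$, and such that $\partial^\alpha(\mathcal F\eta-1)(0)=0$ for all $0\le|\alpha|<N$, where $\mathcal F\eta(\xi)=\int_{\mathbb R^n}\eta(x)e^{-2\pi i(x,\xi)}\,dx$. For $h>0$ and $\kappa_1,\kappa_2,c>0$ let $X\subset\mathbb R^n$ be a set of nodes with the following properties. (1) For every $j\in\mathbb Z^n$ the open ball $B(hj,h\kappa_1)$ contains a node of $X$. (2) For every $j\in\mathbb Z^n$ there are given a node $\tilde x_j\in X$ closest to $hj$ and a star $\mathrm{st}(\tilde x_j)\subset X\cap B(\tilde x_j,h\kappa_2)$ consisting of $m_N=\frac{(N-1+n)!}{n!\,(N-1)!}-1$ nodes, such that the Vandermonde matrix $$V_{j,h}=\Big\{\Big(\frac{x_k-\tilde x_j}{h}\Big)^{\alpha}\Big\}_{x_k\in\mathrm{st}(\tilde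 x_j),\ 1\le|\alpha|\le N-1}$$ satisfies $|\det V_{j,h}|\ge c$; moreover $\bigcup_{j\in\mathbb Z^n}\big(\{\tilde x_j\}\cup\mathrm{st}(\tilde x_j)\big)=X$. Let $b^{(j)}_{\alpha,k}$ be the entries of $V_{j,h}^{-1}$, and put $$\Lambda_j(u)=u(\tilde x_j)\Big(1-\sum_{|\alpha|=1}^{N-1}\Big(j-\frac{\tilde x_j}{h}\Big)^{\alpha}\sum_{x_k\in\mathrm{st}(\tilde x_j)}b^{(j)}_{\alpha,k}\Big)+\sum_{x_k\in\mathrm{st}(\tilde x_j)}u(x_k)\sum_{|\alpha|=1}^{N-1}b^{(j)}_{\alpha,k}\Big(j-\frac{\tilde x_j}{h}\Big)^{\alpha},$$ $$\mathbb M u(x)=D^{-n/2}\sum_{j\in\mathbb Z^n}\Lambda_j(u)\,\eta\Big(\frac{x-hj}{h\sqrt D}\Big).$$ Then for every $\varepsilon>0$ there is $D>0$, not depending on the nodes or on $h$, such that for all $\kappa_1,\kappa_2,c>0$ there is a constant $C$ with the following property: for all $h>0$, all nodes and stars satisfying (1) and (2) with the constants $\kappa_1,\kappa_2,c$, and all $u\in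 W^N_\infty(\mathbb R^n)$ (complex-valued and identified with its continuous representative), the function $u$ is of class $C^{N-1}$, and for every $x\in\mathbb R^n$ the series defining $\mathbb M u(x)$ converges absolutely and $$|\mathbb M u(x)-u(x)|\le C\,h^N\sup_{\mathbb R^n}|\nabla_N u|+\varepsilon\sum_{k=0}^{N-1}|\nabla_k u(x)|\,(\sqrt D\,h)^k .$$ Here $\nabla_k u$ is the vector of all partial derivatives of $u$ of order $k$ and $|\cdot|$ is the Euclidean norm; for $k=N$ the derivatives are weak and the supremum is the essential supremum. In particular $C$ depends neither on $u$ nor on $h$. -/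

import Mathlib

open MeasureTheory FourierTransform
open scoped ENNReal ContDiff

noncomputable section

namespace QuasiInterp

/-- Euclidean space of dimension `n`. -/
abbrev E (n : ℕ) : Type := EuclideanSpace ℝ (Fin n)

/-- The monomial `x ^ α` for a multi-index `α`. -/
def monom {n : ℕ} (α : Fin n → ℕ) (x : E n) : ℝ := ∏ i, x i ^ α i

/-- The directions of differentiation in `∂^α`: the basis vector `e i` repeated `α i` times,
for each `i`. -/
def directions {n : ℕ} (α : Fin n → ℕ) : Fin (∑ i, α i) → E n :=
  fun m => EuclideanSpace.single (finSigmaFinEquiv.symm m).1 1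

/-- The classical partial derivative `∂^α f` at `x` (used for `f` of class `C^|α|`). -/
def partialD {n : ℕ} {F : Type*} [NormedAddCommGroup F] [NormedSpace ℝ F]
    (α : Fin n → ℕ) (f : E n → F) (x : E n) : F :=
  iteratedFDeriv ℝ (∑ i, α i) f x (directions α)

/-- `|∇_k u(x)|`, the Euclidean norm of the vector of all classical partial derivatives of
order `k` at `x`. -/
def gradNorm {n : ℕ} (k : ℕ) (u : E n → ℂ) (x : E n) : ℝ :=
  Real.sqrt (∑ α ∈ Finset.piAntidiag (Finset.univ : Finset (Fin n)) k, ‖partialD α u x‖ ^ 2)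

/-- `g` is the weak derivative `∂^α u` on the whole space. -/
def HasWeakDeriv {n : ℕ} (α : Fin n → ℕ) (u g : E n → ℂ) : Prop :=
  LocallyIntegrable u volume ∧ LocallyIntegrable g volume ∧
    ∀ φ : E n → ℝ, ContDiff ℝ ∞ φ → HasCompactSupport φ →
      ∫ x, partialD α φ x • u x = (-1 : ℂ) ^ (∑ i, α i) * ∫ x, φ x • g x

/-- The Sobolev space `W^N_∞`: all weak derivatives of order at most `N` exist and are
essentially bounded. -/
def MemSobolevInf {n : ℕ} (N : ℕ) (u : E n → ℂ) : Prop :=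
  ∀ α : Fin n → ℕ, ∑ i, α i ≤ N → ∃ g, HasWeakDeriv α u g ∧ MemLp g ∞ volume

open Classical in
/-- A representative of the weak derivative `∂^α u` (unique almost everywhere). -/
def weakD {n : ℕ} (α : Fin n → ℕ) (u : E n → ℂ) : E n → ℂ :=
  if hg : ∃ g, HasWeakDeriv α u g then hg.choose else 0

/-- `sup |∇_N u|` over the whole space: the essential supremum of the Euclidean norm of the
vector of all weak derivatives of order `N`. -/
def supGrad {n : ℕ} (N : ℕ) (u : E n → ℂ) : ℝ :=
  (eLpNorm (fun x => Real.sqrt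
    (∑ α ∈ Finset.piAntidiag (Finset.univ : Finset (Fin n)) N, ‖weakD α u x‖ ^ 2))
    ∞ volume).toReal

/-- The multi-indices `α` with `1 ≤ |α| ≤ N - 1`. -/
def multiIdx (n N : ℕ) : Finset (Fin n → ℕ) :=
  (Finset.Ico 1 N).biUnion fun k => Finset.piAntidiag Finset.univ k

theorem mem_multiIdx {n N : ℕ} {α : Fin n → ℕ} :
    α ∈ multiIdx n N ↔ 1 ≤ ∑ i, α i ∧ ∑ i, α i < N := by
  simp [multiIdx]

/-- There are `m_N = (N - 1 + n)! / (n! (N - 1)!) - 1` such multi-indices, so that a star can be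
enumerated by them. -/
theorem card_multiIdx (n N : ℕ) (hN : 1 ≤ N) :
    (multiIdx n N).card = (N - 1 + n).choose n - 1 := by
  have hcard : ∀ k, (Finset.piAntidiag (Finset.univ : Finset (Fin n)) k).card =
      n.multichoose k := by
    intro k
    rw [← Finset.map_sym_eq_piAntidiag, Finset.card_map, Finset.sym_univ, Finset.card_univ,
      Sym.card_sym_eq_multichoose, Fintype.card_fin]
  obtain ⟨M, rfl⟩ : ∃ M, N = M + 1 := ⟨N - 1, by omega⟩
  rw [multiIdx, Finset.card_biUnion]
  · have hsum := Nat.sum_range_multichoose M n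
    rw [← Finset.sum_erase_add _ _ (Finset.mem_range.2 (Nat.succ_pos M))] at hsum
    have hset : (Finset.range (M + 1)).erase 0 = Finset.Ico 1 (M + 1) := by
      ext a
      simp [Finset.mem_Ico, Nat.one_le_iff_ne_zero]
    rw [hset] at hsum
    simp only [hcard]
    simp only [Nat.multichoose_zero_right] at hsum
    simp only [Nat.add_sub_cancel]
    omega
  · intro a _ b _ hab
    change Disjoint _ _
    rw [Finset.disjoint_left]
    intro α ha hb
    simp only [Finset.mem_piAntidiag] at ha hb
    exact hab (ha.1.symm.trans hb.1)

/-- A collection of `m_N` points, enumerated (in an arbitrary order) by the multi-indices `α`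
with `1 ≤ |α| ≤ N - 1`. -/
abbrev StarPts (n N : ℕ) : Type := multiIdx n N → E n

/-- The Vandermonde matrix with entries `((x_k - x₀) / h) ^ α`. -/
def vander {n N : ℕ} (h : ℝ) (x₀ : E n) (s : StarPts n N) :
    Matrix (multiIdx n N) (multiIdx n N) ℝ :=
  Matrix.of fun k α => monom α.1 (h⁻¹ • (s k - x₀))

/-- The integer point `j`, as a point of Euclidean space. -/
def intPt {n : ℕ} (j : Fin n → ℤ) : E n := WithLp.toLp 2 fun i => (j i : ℝ)

/-- Every ball `B(h j, h κ₁)`, `j` an integer point, contains nodes of `X`. -/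
def NearGrid {n : ℕ} (X : Set (E n)) (h κ₁ : ℝ) : Prop :=
  0 < h ∧ 0 < κ₁ ∧ ∀ j : Fin n → ℤ, (X ∩ Metric.ball (h • intPt j) (h * κ₁)).Nonempty

/-- `xt j` is a node of `X` closest to `h j`, and `st j` is a star of `xt j`, made of nodes of
`X` in `B(xt j, h κ₂)`, with `|det V_{j,h}| ≥ c`; the nodes `xt j` together with their
stars exhaust `X`. -/
structure StarSystem {n N : ℕ} (X : Set (E n)) (h κ₂ c : ℝ)
    (xt : (Fin n → ℤ) → E n) (st : (Fin n → ℤ) → StarPts n N) : Prop where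
  node_mem : ∀ j, xt j ∈ X
  node_closest : ∀ j, ∀ y ∈ X, dist (xt j) (h • intPt j) ≤ dist y (h • intPt j)
  star_mem : ∀ j k, st j k ∈ X
  κ₂_pos : 0 < κ₂
  star_ball : ∀ j k, st j k ∈ Metric.ball (xt j) (h * κ₂)
  c_pos : 0 < c
  det_ge : ∀ j, c ≤ |(vander h (xt j) (st j)).det|
  exhaust : ⋃ j, insert (xt j) (Set.range (st j)) = X

/-- The functional `Λ_j(u)`, for the node `x₀` closest to `h j` and its star `s`. -/
def lam {n N : ℕ} (h : ℝ) (j : Fin n → ℤ) (x₀ : E n) (s : StarPts n N) (u : E n → ℂ) : ℂ :=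
  (1 - ∑ α : multiIdx n N, monom α.1 (intPt j - h⁻¹ • x₀) *
      ∑ k : multiIdx n N, (vander h x₀ s)⁻¹ α k) • u x₀ +
    ∑ k : multiIdx n N, (∑ α : multiIdx n N,
      (vander h x₀ s)⁻¹ α k * monom α.1 (intPt j - h⁻¹ • x₀)) • u (s k)

/-- The term of index `j` of the series `∑ Λ_j(u) η((x - h j) / (h √D))`. -/
def summand {n N : ℕ} (η : E n → ℂ) (D h : ℝ) (xt : (Fin n → ℤ) → E n)
    (st : (Fin n → ℤ) → StarPts n N) (u : E n → ℂ) (x : E n) (j : Fin n → ℤ) : ℂ :=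
  lam h j (xt j) (st j) u * η ((h * Real.sqrt D)⁻¹ • (x - h • intPt j))

/-- The quasi-interpolant with gridded centers. -/
def quasi {n N : ℕ} (η : E n → ℂ) (D h : ℝ) (xt : (Fin n → ℤ) → E n)
    (st : (Fin n → ℤ) → StarPts n N) (u : E n → ℂ) (x : E n) : ℂ :=
  D ^ (-(n : ℝ) / 2) • ∑' j : Fin n → ℤ, summand η D h xt st u x j

end QuasiInterp

end

/-!
The error of the quasi-interpolant is split by means of the Taylor polynomial `T` of `u` at the
point `x`, of degree less than `N`. Two facts about the functionals `Λ_j` are used. They reproduce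
polynomials of degree less than `N`, `Λ_j(T) = T(h j)`, which is the identity `V⁻¹ V = 1` for the
Vandermonde matrix (`lam_taylorPoly`), and their coefficients are bounded in terms of `κ₁`, `κ₂`
and `c`, by Cramer's rule (`exists_norm_lam_le`).

The sum with `T(h j)` in place of `Λ_j(u)` is a combination of the discrete moments
`δ ^ n ∑ g(δ (z - j))`, where `g` is a monomial of degree less than `N` times `η`, `δ = D ^ (-1/2)`
and `z = x / h`. These are Riemann sums, so as `δ → 0` they converge, uniformly in `z`, to the
moments of `η` (`eventually_riemannSum_close`). By the hypothesis on `𝓕 η` the moments of order less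
than `N` are those of a point mass at the origin (`integral_prod_smul_eq`). A small `δ` therefore
makes this part of the error at most `ε ∑ |∇_k u(x)| (√D h)^k` (`taylorPoly_sum_close`).

The remainder `R = u - T` satisfies `|R(y)| ≤ C sup |∇_N u| |y - x| ^ N`. Since all nodes that enter
`Λ_j` are within `h (κ₁ + κ₂)` of `h j`, the decay of `η` makes the sum of `|Λ_j(R) η|` at most
`C h ^ N sup |∇_N u|`, uniformly in `x` (`norm_lam_mul_le`, `exists_tsum_one_add_norm_rpow_le`).

The regularity of `u` and Taylor's formula are obtained by mollification
(`MemSobolevInf.contDiff_and_taylor`): the mollified functions are smooth, their derivatives of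
order at most `N` are bounded by the weak derivatives of `u`, and such bounds together with pointwise
convergence imply convergence of the derivatives of lower order (`contDiff_of_tendsto_of_bounded`).
-/

noncomputable section

namespace QuasiInterp

open Filter Topology Equiv

/-! ### Symmetry of higher derivatives and Taylor's formula -/

section Multilinear

variable {V F : Type*} [NormedAddCommGroup V] [NormedSpace ℝ V]
  [NormedAddCommGroup F] [NormedSpace ℝ F]

/-- The first two arguments of an iterated derivative are those of a second derivative. -/
theorem iteratedFDeriv_add_two_apply {k : ℕ} {f : V → F} (hf : ContDiff ℝ (k + 2 : ℕ) f) (x : V)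
    (w : Fin (k + 2) → V) :
    iteratedFDeriv ℝ (k + 2) f x w =
      fderiv ℝ (fderiv ℝ fun y => iteratedFDeriv ℝ k f y fun i => w i.succ.succ) x (w 0) (w 1) := by
  have hg : ContDiff ℝ 2 (iteratedFDeriv ℝ k f) :=
    hf.iteratedFDeriv_right (by norm_cast; omega)
  have hgd : Differentiable ℝ (iteratedFDeriv ℝ k f) := hg.differentiable (by simp)
  have hd : Differentiable ℝ (iteratedFDeriv ℝ (k + 1) f) :=
    hf.differentiable_iteratedFDeriv (by norm_cast; omega)
  have hc : ContDiff ℝ 2 fun y => iteratedFDeriv ℝ k f y fun i => w i.succ.succ :=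
    (ContinuousMultilinearMap.apply ℝ (fun _ : Fin k => V) F _).contDiff.comp hg
  rw [(hd x).iteratedFDeriv_succ_apply_left']
  have : (fun y => iteratedFDeriv ℝ (k + 1) f y (Fin.tail w)) =
      fun y => fderiv ℝ (fun y => iteratedFDeriv ℝ k f y fun i => w i.succ.succ) y (w 1) := by
    ext y
    rw [(hgd y).iteratedFDeriv_succ_apply_left']
    rfl
  rw [this, fderiv_clm_apply (((hc.fderiv_right (m := 1) (by norm_num)).differentiable
    (by simp)) x) (differentiableAt_const _)]
  simp

/-- The iterated derivative of a function of class `C^k` is symmetric. It is enough to treat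
transpositions of neighbours: the first two arguments are exchanged by the symmetry of second
derivatives, the others by differentiating the identity for the order `k - 1`. -/
theorem iteratedFDeriv_comp_perm_of_contDiff {k : ℕ} {f : V → F} (hf : ContDiff ℝ k f) (x : V)
    (v : Fin k → V) (σ : Perm (Fin k)) :
    iteratedFDeriv ℝ k f x (v ∘ σ) = iteratedFDeriv ℝ k f x v := by
  induction k generalizing x with
  | zero => congr 1; exact Subsingleton.elim _ _
  | succ k ih =>
    have hk : ContDiff ℝ k f := hf.of_le (by norm_cast; omega)
    have hdiff : Differentiable ℝ (iteratedFDeriv ℝ k f) :=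
      hf.differentiable_iteratedFDeriv (by norm_cast; omega)
    have key : ∀ (i : Fin k) (w : Fin (k + 1) → V),
        iteratedFDeriv ℝ (k + 1) f x (w ∘ swap i.castSucc i.succ) =
          iteratedFDeriv ℝ (k + 1) f x w := by
      intro i w
      cases k with
      | zero => exact i.elim0
      | succ k =>
        refine Fin.cases ?_ (fun j => ?_) i
        · have hc : ContDiff ℝ 2 fun y => iteratedFDeriv ℝ k f y fun i => w i.succ.succ :=
            (ContinuousMultilinearMap.apply ℝ (fun _ : Fin k => V) F _).contDiff.comp
              (hf.iteratedFDeriv_right (by norm_cast; omega))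
          rw [iteratedFDeriv_add_two_apply hf, iteratedFDeriv_add_two_apply hf]
          have hs := (hc.contDiffAt (x := x)).isSymmSndFDerivAt (by simp)
          have h1 : (w ∘ swap (Fin.castSucc 0) (Fin.succ 0)) 0 = w 1 := by simp
          have h2 : (w ∘ swap (Fin.castSucc 0) (Fin.succ 0)) 1 = w 0 := by simp
          have h3 : (fun i : Fin k => (w ∘ swap (Fin.castSucc 0) (Fin.succ 0)) i.succ.succ) =
              fun i => w i.succ.succ := by
            ext1 i
            simp only [Function.comp_apply]
            rw [swap_apply_of_ne_of_ne]
            · simp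
            · simp [Fin.ext_iff]
          rw [h1, h2, h3]
          exact hs _ _
        · rw [(hdiff x).iteratedFDeriv_succ_apply_left', (hdiff x).iteratedFDeriv_succ_apply_left']
          have h1 : (w ∘ swap (Fin.castSucc j.succ) (Fin.succ j.succ)) 0 = w 0 := by
            simp only [Function.comp_apply]
            rw [swap_apply_of_ne_of_ne] <;> simp [Fin.ext_iff]
          have h2 : Fin.tail (w ∘ swap (Fin.castSucc j.succ) (Fin.succ j.succ)) =
              Fin.tail w ∘ swap j.castSucc j.succ := by
            ext1 i
            simp only [Fin.tail, Function.comp_apply]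
            congr 1
            rw [Fin.castSucc_succ]
            exact ((Fin.succ_injective _).map_swap _ _ _).symm
          rw [h1, h2]
          congr 2
          ext1 y
          exact ih hk y _ _
    have hσ : σ ∈ Submonoid.closure (Set.range fun i : Fin k => swap i.castSucc i.succ) := by
      rw [Perm.mclosure_swap_castSucc_succ]; trivial
    induction hσ using Submonoid.closure_induction generalizing v with
    | mem σ h => obtain ⟨i, rfl⟩ := h; exact key i v
    | one => rfl
    | mul σ τ _ _ h1 h2 =>
      have : v ∘ ⇑(σ * τ) = (v ∘ σ) ∘ τ := rfl
      rw [this, h2, h1]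

/-- Taylor's formula with a bound on the remainder. -/
theorem norm_sub_taylor_le [CompleteSpace F] {N : ℕ} {f : V → F}
    (hf : ContDiff ℝ (N + 1 : ℕ) f) {B : ℝ}
    (hB : ∀ x, ‖iteratedFDeriv ℝ (N + 1) f x‖ ≤ B) (x y : V) :
    ‖f y - ∑ k ∈ Finset.range (N + 1), (k.factorial : ℝ)⁻¹ •
      iteratedFDeriv ℝ k f x fun _ => y - x‖ ≤ B * ‖y - x‖ ^ (N + 1) := by
  have h := map_add_eq_sum_add_integral_iteratedFDeriv (f := f) (x := x) (y := y - x) (n := N)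
    fun t _ => by exact_mod_cast hf.contDiffAt
  rw [add_sub_cancel] at h
  rw [h, add_sub_cancel_left, norm_smul]
  have hB0 : 0 ≤ B := (norm_nonneg _).trans (hB x)
  have h1 : ‖∫ t in (0 : ℝ)..1, (1 - t) ^ N • iteratedFDeriv ℝ (N + 1) f (x + t • (y - x))
      fun _ => y - x‖ ≤ B * ‖y - x‖ ^ (N + 1) * |1 - 0| := by
    apply intervalIntegral.norm_integral_le_of_norm_le_const
    intro t ht
    rw [Set.uIoc_of_le zero_le_one] at ht
    rw [norm_smul]
    have h2 : ‖(1 - t) ^ N‖ ≤ 1 := by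
      rw [norm_pow]
      apply pow_le_one₀ (norm_nonneg _)
      rw [Real.norm_eq_abs, abs_le]
      constructor <;> linarith [ht.1, ht.2]
    have h3 := ContinuousMultilinearMap.le_opNorm
      (iteratedFDeriv ℝ (N + 1) f (x + t • (y - x))) (fun _ => y - x)
    rw [Finset.prod_const, Finset.card_univ, Fintype.card_fin] at h3
    calc _ ≤ 1 * (‖iteratedFDeriv ℝ (N + 1) f (x + t • (y - x))‖ * ‖y - x‖ ^ (N + 1)) := by gcongr
      _ ≤ _ := by rw [one_mul]; gcongr; exact hB _
  have h2 : ‖((N.factorial : ℝ)⁻¹)‖ ≤ 1 := by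
    rw [norm_inv, Real.norm_natCast]
    exact inv_le_one_of_one_le₀ (by exact_mod_cast N.factorial_pos)
  calc _ ≤ 1 * (B * ‖y - x‖ ^ (N + 1) * |1 - 0|) := by gcongr
    _ = _ := by simp

end Multilinear

/-! ### Derivatives in coordinates -/

section Coordinates

variable {n : ℕ} {F : Type*} [NormedAddCommGroup F] [NormedSpace ℝ F]

/-- A multilinear map on Euclidean space is determined by its values on basis vectors. -/
theorem multilinear_apply_eq_sum {k : ℕ} (A : ContinuousMultilinearMap ℝ (fun _ : Fin k => E n) F)
    (v : Fin k → E n) :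
    A v = ∑ f : Fin k → Fin n, (∏ i, v i (f i)) • A fun i => EuclideanSpace.single (f i) 1 := by
  have hv : v = fun i => ∑ l : Fin n, v i l • (EuclideanSpace.single l (1 : ℝ) : E n) := by
    ext i l
    simp [Finset.sum_apply, Pi.single_apply]
  conv_lhs => rw [hv]
  rw [A.map_sum]
  exact Finset.sum_congr rfl fun f _ => A.map_smul_univ _ _

theorem norm_multilinear_le {k : ℕ} (A : ContinuousMultilinearMap ℝ (fun _ : Fin k => E n) F)
    {B : ℝ} (hB : ∀ f : Fin k → Fin n, ‖A fun i => EuclideanSpace.single (f i) 1‖ ≤ B)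
    (hB0 : 0 ≤ B) : ‖A‖ ≤ n ^ k * B := by
  refine A.opNorm_le_bound (by positivity) fun v => ?_
  rw [multilinear_apply_eq_sum]
  calc _ ≤ ∑ _f : Fin k → Fin n, (∏ i, ‖v i‖) * B := by
        refine norm_sum_le_of_le _ fun f _ => ?_
        rw [norm_smul, norm_prod]
        gcongr with i
        · exact PiLp.norm_apply_le _ _
        · exact hB f
    _ = _ := by simp; ring

/-- Directional derivatives along basis vectors depend only on how often each of them occurs. -/
theorem iteratedFDeriv_single_eq_of_card_fiber {k l : ℕ} {u : E n → F} (hu : ContDiff ℝ k u)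
    (hkl : k = l) (f : Fin k → Fin n) (g : Fin l → Fin n)
    (hfg : ∀ i, Fintype.card {m // f m = i} = Fintype.card {m // g m = i}) (x : E n) :
    iteratedFDeriv ℝ k u x (fun i => EuclideanSpace.single (f i) 1) =
      iteratedFDeriv ℝ l u x (fun i => EuclideanSpace.single (g i) 1) := by
  subst hkl
  let σ : Perm (Fin k) := Equiv.ofFiberEquiv fun i => Fintype.equivOfCardEq (hfg i)
  have hσ : ∀ m, g (σ m) = f m := Equiv.ofFiberEquiv_map _
  rw [← iteratedFDeriv_comp_perm_of_contDiff hu x (fun i => EuclideanSpace.single (g i) 1) σ]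
  simp only [Function.comp_def, hσ]

/-- The multi-index that counts how often each coordinate occurs in `f`. -/
def countIdx {k : ℕ} (f : Fin k → Fin n) (i : Fin n) : ℕ := Fintype.card {m // f m = i}

theorem sum_countIdx {k : ℕ} (f : Fin k → Fin n) : ∑ i, countIdx f i = k := by
  simp only [countIdx]
  rw [← Fintype.card_sigma, Fintype.card_congr (Equiv.sigmaFiberEquiv f), Fintype.card_fin]

theorem iteratedFDeriv_single_eq_partialD {k : ℕ} {u : E n → F} (hu : ContDiff ℝ k u)
    (f : Fin k → Fin n) (x : E n) :
    iteratedFDeriv ℝ k u x (fun i => EuclideanSpace.single (f i) 1) =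
      partialD (countIdx f) u x := by
  refine iteratedFDeriv_single_eq_of_card_fiber hu (sum_countIdx f).symm f
    (fun m => (finSigmaFinEquiv.symm m).1) (fun i => ?_) x
  have e : {m // (finSigmaFinEquiv (n := countIdx f).symm m).1 = i} ≃ Fin (countIdx f i) :=
    (finSigmaFinEquiv.symm.subtypeEquiv fun _ => Iff.rfl).trans (Equiv.sigmaSubtype i)
  rw [Fintype.card_congr e, Fintype.card_fin]
  rfl

/-- A partial derivative is bounded by the norm of the gradient of its order. -/
theorem norm_iteratedFDeriv_single_le_gradNorm {k : ℕ} {u : E n → ℂ} (hu : ContDiff ℝ k u)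
    (f : Fin k → Fin n) (x : E n) :
    ‖iteratedFDeriv ℝ k u x (fun i => EuclideanSpace.single (f i) 1)‖ ≤ gradNorm k u x := by
  rw [iteratedFDeriv_single_eq_partialD hu, gradNorm]
  apply Real.le_sqrt_of_sq_le
  exact Finset.single_le_sum (f := fun α => ‖partialD α u x‖ ^ 2) (fun _ _ => by positivity)
    (by simp [sum_countIdx])

theorem partialD_of_sum_eq_zero {α : Fin n → ℕ} (hα : ∑ i, α i = 0) (u : E n → F) (x : E n) :
    partialD α u x = u x := by
  have : ∀ (k : ℕ) (v : Fin k → E n), k = 0 → iteratedFDeriv ℝ k u x v = u x := by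
    rintro _ v rfl
    simp
  exact this _ _ hα

end Coordinates

/-! ### Limits of functions with bounded derivatives -/

section Limits

variable {n : ℕ}

/-- The operator norm is controlled by the images of the basis vectors. -/
theorem norm_clm_le_sum {F : Type*} [NormedAddCommGroup F] [NormedSpace ℝ F] (A : E n →L[ℝ] F) :
    ‖A‖ ≤ ∑ i, ‖A (EuclideanSpace.single i 1)‖ := by
  refine A.opNorm_le_bound (by positivity) fun v => ?_
  have hv : v = ∑ l : Fin n, v l • (EuclideanSpace.single l (1 : ℝ) : E n) := by
    ext l
    simp [Finset.sum_apply, Pi.single_apply]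
  conv_lhs => rw [hv]
  rw [map_sum, Finset.sum_mul]
  refine norm_sum_le_of_le _ fun i _ => ?_
  rw [map_smul, norm_smul, mul_comm]
  gcongr
  exact PiLp.norm_apply_le _ _

/-- A pointwise convergent sequence of functions with uniformly bounded second derivatives has
convergent first derivatives: difference quotients with a fixed small step converge, and they
approximate the derivatives uniformly in the sequence. -/
theorem exists_tendsto_fderiv {F : Type*} [NormedAddCommGroup F] [NormedSpace ℝ F]
    [CompleteSpace F] {v : ℕ → E n → F} {w : E n → F} {B : ℝ}
    (hv : ∀ m, ContDiff ℝ 2 (v m)) (hB : ∀ m x, ‖iteratedFDeriv ℝ 2 (v m) x‖ ≤ B)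
    (hw : ∀ x, Tendsto (fun m => v m x) atTop (𝓝 (w x))) :
    ∃ G : E n → E n →L[ℝ] F, (∀ x, Tendsto (fun m => fderiv ℝ (v m) x) atTop (𝓝 (G x))) ∧
      ∀ x, HasFDerivAt w (G x) x := by
  have taylor : ∀ m x y, ‖v m y - v m x - fderiv ℝ (v m) x (y - x)‖ ≤ B * ‖y - x‖ ^ 2 := by
    intro m x y
    have h := norm_sub_taylor_le (N := 1) (hv m) (hB m) x y
    simpa [Finset.sum_range_succ, sub_sub] using h
  have hB0 : 0 ≤ B := (norm_nonneg _).trans (hB 0 0)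
  have hdir : ∀ x i, CauchySeq fun m => fderiv ℝ (v m) x (EuclideanSpace.single i 1) := by
    intro x i
    set e : E n := EuclideanSpace.single i 1 with he
    have hen : ‖e‖ = 1 := by simp [he]
    rw [Metric.cauchySeq_iff']
    intro ε hε
    -- the step `t` makes the error `B * t` of the difference quotient less than `ε / 4`
    obtain ⟨t, ht0, ht⟩ : ∃ t : ℝ, 0 < t ∧ B * t < ε / 4 := by
      refine ⟨ε / 4 / (B + 1), by positivity, ?_⟩
      rw [mul_div_assoc', div_lt_iff₀ (by positivity)]
      nlinarith
    have hq : Tendsto (fun m => v m (x + t • e) - v m x) atTop (𝓝 (w (x + t • e) - w x)) :=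
      (hw _).sub (hw _)
    obtain ⟨M, hM⟩ := Metric.cauchySeq_iff'.1 hq.cauchySeq (t * (ε / 4)) (by positivity)
    refine ⟨M, fun m hm => ?_⟩
    have h1 : ∀ m, ‖v m (x + t • e) - v m x - t • fderiv ℝ (v m) x e‖ ≤ B * t ^ 2 := by
      intro m
      have := taylor m x (x + t • e)
      simpa [add_sub_cancel_left, norm_smul, hen, abs_of_pos ht0] using this
    have h2 := hM m hm
    rw [dist_eq_norm] at h2 ⊢
    have h3 : ‖t • (fderiv ℝ (v m) x e - fderiv ℝ (v M) x e)‖ ≤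
        B * t ^ 2 + B * t ^ 2 + t * (ε / 4) := by
      have h4 : t • (fderiv ℝ (v m) x e - fderiv ℝ (v M) x e) =
          (v M (x + t • e) - v M x - t • fderiv ℝ (v M) x e) -
          (v m (x + t • e) - v m x - t • fderiv ℝ (v m) x e) +
          (v m (x + t • e) - v m x - (v M (x + t • e) - v M x)) := by
        rw [smul_sub]; abel
      rw [h4]
      refine (norm_add_le _ _).trans (add_le_add ((norm_sub_le _ _).trans ?_) h2.le)
      exact add_le_add (h1 M) (h1 m)
    rw [norm_smul, Real.norm_eq_abs, abs_of_pos ht0] at h3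
    have h5 : t * ‖fderiv ℝ (v m) x e - fderiv ℝ (v M) x e‖ < t * ε := by
      nlinarith
    exact lt_of_mul_lt_mul_left h5 ht0.le
  have hcau : ∀ x, CauchySeq fun m => fderiv ℝ (v m) x := by
    intro x
    rw [cauchySeq_iff_tendsto_dist_atTop_0]
    have h := fun i => cauchySeq_iff_tendsto_dist_atTop_0.1 (hdir x i)
    have hs := tendsto_finsetSum (Finset.univ : Finset (Fin n)) fun i _ => h i
    simp only [Finset.sum_const_zero] at hs
    refine squeeze_zero (fun _ => dist_nonneg) (fun p => ?_) hs
    rw [dist_eq_norm]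
    refine (norm_clm_le_sum _).trans (le_of_eq ?_)
    simp [dist_eq_norm]
  choose G hG using fun x => cauchySeq_tendsto_of_complete (hcau x)
  refine ⟨G, hG, fun x => ?_⟩
  have hlim : ∀ y, ‖w y - w x - G x (y - x)‖ ≤ B * ‖y - x‖ ^ 2 := by
    intro y
    have : Tendsto (fun m => fderiv ℝ (v m) x (y - x)) atTop (𝓝 (G x (y - x))) :=
      ((ContinuousLinearMap.apply ℝ F (y - x)).continuous.tendsto (G x)).comp (hG x)
    exact le_of_tendsto (((hw y).sub (hw x)).sub this).norm
      (Eventually.of_forall fun m => taylor m x y)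
  rw [hasFDerivAt_iff_isLittleO]
  have h1 : (fun y => w y - w x - G x (y - x)) =O[𝓝 x] fun y => ‖y - x‖ ^ 2 :=
    Asymptotics.IsBigO.of_bound B (Eventually.of_forall fun y => by
      simpa using hlim y)
  refine h1.trans_isLittleO ?_
  have h2 : (fun y : E n => ‖y - x‖ ^ 2) =o[𝓝 x] fun y => ‖y - x‖ ^ 1 := by
    refine (Asymptotics.isLittleO_pow_pow (𝕜 := ℝ) one_lt_two).comp_tendsto ?_
    have : Continuous fun y : E n => ‖y - x‖ := by fun_prop
    simpa using this.tendsto x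
  simpa using h2.trans_isBigO (g := fun y => ‖y - x‖ ^ 1) (Asymptotics.isBigO_refl _ _)

/-- If smooth functions converge pointwise and their derivatives of the orders `1, …, N + 1` are
bounded uniformly, then the limit is of class `C^N`, and the derivatives up to the order `N`
converge to those of the limit. -/
theorem contDiff_of_tendsto_of_bounded (N : ℕ) {F : Type} [NormedAddCommGroup F] [NormedSpace ℝ F]
    [CompleteSpace F] {v : ℕ → E n → F} {w : E n → F} {B : ℕ → ℝ}
    (hv : ∀ m, ContDiff ℝ ∞ (v m))
    (hB : ∀ k, 1 ≤ k → k ≤ N + 1 → ∀ m x, ‖iteratedFDeriv ℝ k (v m) x‖ ≤ B k)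
    (hw : ∀ x, Tendsto (fun m => v m x) atTop (𝓝 (w x))) :
    ContDiff ℝ N w ∧ ∀ k ≤ N, ∀ x,
      Tendsto (fun m => iteratedFDeriv ℝ k (v m) x) atTop (𝓝 (iteratedFDeriv ℝ k w x)) := by
  have hzero : ∀ x, Tendsto (fun m => iteratedFDeriv ℝ 0 (v m) x) atTop
      (𝓝 (iteratedFDeriv ℝ 0 w x)) := by
    intro x
    simp only [iteratedFDeriv_zero_eq_comp, Function.comp_apply]
    exact ((LinearIsometryEquiv.continuous _).tendsto _).comp (hw x)
  induction N generalizing F B with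
  | zero =>
    refine ⟨?_, fun k hk => by obtain rfl : k = 0 := by omega
                               exact hzero⟩
    have hl : ∀ x y, ‖w y - w x‖ ≤ B 1 * ‖y - x‖ := by
      intro x y
      refine le_of_tendsto ((hw y).sub (hw x)).norm (Eventually.of_forall fun m => ?_)
      have h := norm_sub_taylor_le (N := 0) ((hv m).of_le (by exact_mod_cast le_top))
        (hB 1 le_rfl le_rfl m) x y
      simpa using h
    have hB0 : 0 ≤ B 1 := (norm_nonneg _).trans (hB 1 le_rfl le_rfl 0 0)
    simp only [Nat.cast_zero, contDiff_zero]
    refine (LipschitzWith.of_dist_le_mul (K := (B 1).toNNReal) fun y x => ?_).continuous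
    rw [dist_eq_norm, dist_eq_norm, Real.coe_toNNReal _ hB0]
    exact hl x y
  | succ N ih =>
    obtain ⟨G, hG, hGw⟩ := exists_tendsto_fderiv
      (fun m => by exact_mod_cast contDiff_infty.1 (hv m) 2)
      (hB 2 (by omega) (by omega)) hw
    have hfw : fderiv ℝ w = G := funext fun x => (hGw x).fderiv
    have hvd : ∀ m, ContDiff ℝ ∞ (fderiv ℝ (v m)) := fun m => (hv m).fderiv_right (by simp)
    have hz : ∀ x, Tendsto (fun m => iteratedFDeriv ℝ 0 (fderiv ℝ (v m)) x) atTop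
        (𝓝 (iteratedFDeriv ℝ 0 G x)) := by
      intro x
      simp only [iteratedFDeriv_zero_eq_comp, Function.comp_apply]
      exact ((LinearIsometryEquiv.continuous _).tendsto _).comp (hG x)
    obtain ⟨h1, h2⟩ := ih (B := fun k => B (k + 1)) hvd (fun k _ hk2 m x => by
      rw [norm_iteratedFDeriv_fderiv]
      exact hB (k + 1) (by omega) (by omega) m x) hG hz
    refine ⟨?_, fun k hk x => ?_⟩
    · rw [Nat.cast_add, Nat.cast_one, contDiff_succ_iff_fderiv]
      refine ⟨fun x => (hGw x).differentiableAt, fun h => by simp at h, ?_⟩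
      rw [hfw]
      exact h1
    · cases k with
      | zero => exact hzero x
      | succ k =>
        simp only [iteratedFDeriv_succ_eq_comp_right, Function.comp_apply]
        have h3 := h2 k (by omega) x
        rw [← hfw] at h3
        exact ((LinearIsometryEquiv.continuous _).tendsto _).comp h3

end Limits

/-! ### Derivatives of mollifications -/

section Mollification

variable {n : ℕ}

open scoped Convolution
open ContinuousLinearMap (lsmul)

theorem iteratedFDeriv_succ_apply_last {V F : Type*} [NormedAddCommGroup V] [NormedSpace ℝ V]
    [NormedAddCommGroup F] [NormedSpace ℝ F] {f : V → F} (hf : ContDiff ℝ ∞ f) {k : ℕ} (x : V)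
    (v : Fin (k + 1) → V) :
    iteratedFDeriv ℝ (k + 1) f x v =
      iteratedFDeriv ℝ k (fun y => fderiv ℝ f y (v (Fin.last k))) x (Fin.init v) := by
  rw [iteratedFDeriv_succ_apply_right]
  have h := (ContinuousLinearMap.apply ℝ F (v (Fin.last k))).iteratedFDeriv_comp_left
    (f := fderiv ℝ f) (x := x) (n := ∞) (i := k)
    ((hf.fderiv_right (m := ∞) (by simp)).contDiffAt) (by exact_mod_cast le_top)
  have h2 : (fun y => fderiv ℝ f y (v (Fin.last k))) =
      ⇑(ContinuousLinearMap.apply ℝ F (v (Fin.last k))) ∘ fderiv ℝ f := rfl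
  rw [h2, h]
  rfl

theorem fderiv_convolution_apply {φ : E n → ℝ} {u : E n → ℂ} (hφ : ContDiff ℝ ∞ φ)
    (hφc : HasCompactSupport φ) (hu : LocallyIntegrable u volume) (x e : E n) :
    fderiv ℝ (φ ⋆[lsmul ℝ ℝ, volume] u) x e =
      ((fun y => fderiv ℝ φ y e) ⋆[lsmul ℝ ℝ, volume] u) x := by
  have hflip : ∀ ψ : E n → ℝ, (ψ ⋆[lsmul ℝ ℝ, volume] u) =
      u ⋆[(lsmul ℝ ℝ : ℝ →L[ℝ] ℂ →L[ℝ] ℂ).flip, volume] ψ := fun ψ => (convolution_flip _).symm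
  rw [hflip, hflip,
    (hφc.hasFDerivAt_convolution_right _ hu (hφ.of_le (by exact_mod_cast le_top)) x).fderiv]
  exact convolution_precompR_apply _ hu (hφc.fderiv ℝ) (hφ.continuous_fderiv (by simp)) _ _

theorem contDiff_fderiv_apply {V F : Type*} [NormedAddCommGroup V] [NormedSpace ℝ V]
    [NormedAddCommGroup F] [NormedSpace ℝ F] {f : V → F} (hf : ContDiff ℝ ∞ f) (e : V) :
    ContDiff ℝ ∞ fun y => fderiv ℝ f y e :=
  (hf.fderiv_right (m := ∞) (by simp)).clm_apply contDiff_const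

theorem iteratedFDeriv_convolution_apply {φ : E n → ℝ} {u : E n → ℂ} (hφ : ContDiff ℝ ∞ φ)
    (hφc : HasCompactSupport φ) (hu : LocallyIntegrable u volume) {k : ℕ} (x : E n)
    (v : Fin k → E n) :
    iteratedFDeriv ℝ k (φ ⋆[lsmul ℝ ℝ, volume] u) x v =
      ((fun y => iteratedFDeriv ℝ k φ y v) ⋆[lsmul ℝ ℝ, volume] u) x := by
  induction k generalizing φ with
  | zero => simp
  | succ k ih =>
    have hc : HasCompactSupport fun y => fderiv ℝ φ y (v (Fin.last k)) :=
      hφc.fderiv_apply ℝ _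
    have hs := contDiff_fderiv_apply hφ (v (Fin.last k))
    rw [iteratedFDeriv_succ_apply_last (hφc.contDiff_convolution_left _ hφ hu)]
    simp only [fderiv_convolution_apply hφ hφc hu]
    rw [ih hs hc]
    congr 1
    ext1 y
    rw [iteratedFDeriv_succ_apply_last hφ]

theorem partialD_comp_sub_left {α : Fin n → ℕ} {φ : E n → ℝ} (hφ : ContDiff ℝ ∞ φ) (x y : E n) :
    partialD α (fun z => φ (x - z)) y = (-1) ^ (∑ i, α i) * partialD α φ (x - y) := by
  have h := (-ContinuousLinearMap.id ℝ (E n)).iteratedFDeriv_comp_right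
    (f := fun z => φ (x + z)) (n := ∞) (hφ.comp (contDiff_const.add contDiff_id)) y
    (i := ∑ i, α i) (by exact_mod_cast le_top)
  have h2 : (fun z => φ (x - z)) =
      (fun z => φ (x + z)) ∘ ⇑(-ContinuousLinearMap.id ℝ (E n)) := by
    ext z; simp [sub_eq_add_neg]
  rw [partialD, h2, h, iteratedFDeriv_comp_add_left, partialD]
  simp only [ContinuousMultilinearMap.compContinuousLinearMap_apply]
  have h3 := (iteratedFDeriv ℝ (∑ i, α i) φ (x - y)).map_smul_univ (fun _ => (-1 : ℝ))
    (directions α)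
  simpa [sub_eq_add_neg] using h3

/-- A partial derivative of a mollification is the mollification of the weak derivative. -/
theorem partialD_convolution {α : Fin n → ℕ} {φ : E n → ℝ} {u g : E n → ℂ} (hφ : ContDiff ℝ ∞ φ)
    (hφc : HasCompactSupport φ) (hg : HasWeakDeriv α u g) (x : E n) :
    partialD α (φ ⋆[lsmul ℝ ℝ, volume] u) x = (φ ⋆[lsmul ℝ ℝ, volume] g) x := by
  have hψ : ContDiff ℝ ∞ fun z => φ (x - z) := hφ.comp (contDiff_const.sub contDiff_id)
  have hψc : HasCompactSupport fun z => φ (x - z) :=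
    hφc.comp_homeomorph (Homeomorph.subLeft x)
  have h := hg.2.2 _ hψ hψc
  rw [partialD, iteratedFDeriv_convolution_apply hφ hφc hg.1, convolution_lsmul_swap,
    convolution_lsmul_swap]
  have h1 : ∀ y, partialD α (fun z => φ (x - z)) y • u y =
      (-1 : ℂ) ^ (∑ i, α i) * (partialD α φ (x - y) • u y) := by
    intro y
    rw [partialD_comp_sub_left hφ]
    simp only [Complex.real_smul]
    push_cast
    ring
  simp only [h1] at h
  rw [integral_const_mul] at h
  exact mul_left_cancel₀ (by simp) h

/-- Mollification does not increase essential bounds. -/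
theorem norm_convolution_le_of_ae_le (φ : ContDiffBump (0 : E n)) {g : E n → ℂ} {B : ℝ}
    (hB : ∀ᵐ y, ‖g y‖ ≤ B) (x : E n) :
    ‖(φ.normed volume ⋆[lsmul ℝ ℝ, volume] g) x‖ ≤ B := by
  rw [convolution_lsmul_swap]
  have hi : Integrable fun y => φ.normed volume (x - y) :=
    (φ.integrable_normed (μ := volume)).comp_sub_left x
  have h1 : ‖∫ y, φ.normed volume (x - y) • g y‖ ≤ ∫ y, φ.normed volume (x - y) * B := by
    refine norm_integral_le_of_norm_le (hi.mul_const B) ?_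
    filter_upwards [hB] with y hy
    rw [norm_smul, Real.norm_eq_abs, abs_of_nonneg (φ.nonneg_normed _)]
    gcongr
    exact φ.nonneg_normed _
  rwa [integral_mul_const, integral_sub_left_eq_self (fun y => φ.normed volume y) volume x,
    φ.integral_normed, one_mul] at h1

end Mollification

/-! ### Regularity of functions with bounded weak derivatives -/

section Sobolev

variable {n : ℕ}

/-- Weak derivatives are unique almost everywhere. -/
theorem HasWeakDeriv.ae_eq {α : Fin n → ℕ} {u g₁ g₂ : E n → ℂ} (h₁ : HasWeakDeriv α u g₁)
    (h₂ : HasWeakDeriv α u g₂) : g₁ =ᵐ[volume] g₂ := by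
  refine ae_eq_of_integral_contDiff_smul_eq h₁.2.1 h₂.2.1 fun φ hφ hφc => ?_
  have h := (h₁.2.2 φ hφ hφc).symm.trans (h₂.2.2 φ hφ hφc)
  exact mul_left_cancel₀ (by simp) h

theorem hasWeakDeriv_weakD {α : Fin n → ℕ} {u : E n → ℂ} (h : ∃ g, HasWeakDeriv α u g) :
    HasWeakDeriv α u (weakD α u) := by
  rw [weakD, dif_pos h]
  exact h.choose_spec

theorem MemSobolevInf.hasWeakDeriv {N : ℕ} {u : E n → ℂ} (hu : MemSobolevInf N u)
    {α : Fin n → ℕ} (hα : ∑ i, α i ≤ N) : HasWeakDeriv α u (weakD α u) :=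
  hasWeakDeriv_weakD ((hu α hα).imp fun _ h => h.1)

theorem MemSobolevInf.memLp_weakD {N : ℕ} {u : E n → ℂ} (hu : MemSobolevInf N u)
    {α : Fin n → ℕ} (hα : ∑ i, α i ≤ N) : MemLp (weakD α u) ∞ volume := by
  obtain ⟨g, hg, hgL⟩ := hu α hα
  exact (memLp_congr_ae (hg.ae_eq (hu.hasWeakDeriv hα))).1 hgL

theorem ae_norm_le_of_memLp_top {F : Type*} [NormedAddCommGroup F] {f : E n → F}
    (hf : MemLp f ∞ volume) :
    ∀ᵐ x, ‖f x‖ ≤ (eLpNorm f ∞ volume).toReal := by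
  rw [eLpNorm_exponent_top]
  filter_upwards [enorm_ae_le_eLpNormEssSup f volume] with x hx
  have h := ENNReal.toReal_mono (by simpa using hf.eLpNorm_ne_top) hx
  simpa using h

/-- The weak derivatives of order `N` are bounded by `supGrad N u`. -/
theorem MemSobolevInf.ae_norm_weakD_le {N : ℕ} {u : E n → ℂ} (hu : MemSobolevInf N u)
    {α : Fin n → ℕ} (hα : ∑ i, α i = N) : ∀ᵐ x, ‖weakD α u x‖ ≤ supGrad N u := by
  set G : E n → ℝ := fun x => Real.sqrt
    (∑ α ∈ Finset.piAntidiag (Finset.univ : Finset (Fin n)) N, ‖weakD α u x‖ ^ 2) with hG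
  have hmem : ∀ α ∈ Finset.piAntidiag (Finset.univ : Finset (Fin n)) N,
      MemLp (weakD α u) ∞ volume := by
    intro α hα
    rw [Finset.mem_piAntidiag] at hα
    exact hu.memLp_weakD hα.1.le
  have hGm : AEStronglyMeasurable G volume := by
    refine Real.continuous_sqrt.comp_aestronglyMeasurable ?_
    refine Finset.aestronglyMeasurable_fun_sum _ fun α hα => ?_
    exact (hmem α hα).1.norm.pow 2
  have hGL : MemLp G ∞ volume := by
    refine memLp_top_of_bound hGm (Real.sqrt (∑ α ∈ Finset.piAntidiag
      (Finset.univ : Finset (Fin n)) N, (eLpNorm (weakD α u) ∞ volume).toReal ^ 2)) ?_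
    have h : ∀ᵐ x, ∀ α ∈ Finset.piAntidiag (Finset.univ : Finset (Fin n)) N,
        ‖weakD α u x‖ ≤ (eLpNorm (weakD α u) ∞ volume).toReal :=
      (Finset.eventually_all _).2 fun α hα => ae_norm_le_of_memLp_top (hmem α hα)
    filter_upwards [h] with x hx
    rw [Real.norm_eq_abs, abs_of_nonneg (Real.sqrt_nonneg _)]
    refine Real.sqrt_le_sqrt (Finset.sum_le_sum fun α hα => ?_)
    have := hx α hα
    gcongr
  filter_upwards [ae_norm_le_of_memLp_top hGL] with x hx
  refine le_trans ?_ hx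
  rw [Real.norm_eq_abs, abs_of_nonneg (Real.sqrt_nonneg _)]
  apply Real.le_sqrt_of_sq_le
  exact Finset.single_le_sum (f := fun α => ‖weakD α u x‖ ^ 2) (fun _ _ => by positivity)
    (by simp [hα])

/-- The mollifications of `u` have all their derivatives of order `k ≤ N` bounded, with the bound
given by `supGrad N u` for `k = N`. Passing to the limit gives the regularity of `u` and Taylor's
formula with a remainder of order `N`. -/
theorem MemSobolevInf.contDiff_and_taylor {N : ℕ} {u : E n → ℂ} (hu : MemSobolevInf (N + 1) u)
    (huc : Continuous u) :
    ContDiff ℝ N u ∧ ∀ x y, ‖u y - ∑ k ∈ Finset.range (N + 1), (k.factorial : ℝ)⁻¹ •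
      iteratedFDeriv ℝ k u x fun _ => y - x‖ ≤
        n ^ (N + 1) * supGrad (N + 1) u * ‖y - x‖ ^ (N + 1) := by
  let φ : ℕ → ContDiffBump (0 : E n) := fun m =>
    ⟨1 / (2 * (m + 1)), 1 / (m + 1), by positivity, by
      apply one_div_lt_one_div_of_lt <;> linarith [(Nat.cast_nonneg m : (0 : ℝ) ≤ m)]⟩
  have hφ : Tendsto (fun m => (φ m).rOut) atTop (𝓝 0) := tendsto_one_div_add_atTop_nhds_zero_nat
  have hloc : LocallyIntegrable u volume := huc.locallyIntegrable
  let v : ℕ → E n → ℂ := fun m =>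
    MeasureTheory.convolution ((φ m).normed volume) u (ContinuousLinearMap.lsmul ℝ ℝ) volume
  have hv : ∀ m, ContDiff ℝ ∞ (v m) := fun m =>
    (φ m).hasCompactSupport_normed.contDiff_convolution_left _ (φ m).contDiff_normed hloc
  have hlim : ∀ x, Tendsto (fun m => v m x) atTop (𝓝 (u x)) := fun x =>
    ContDiffBump.convolution_tendsto_right_of_continuous hφ huc x
  have hder : ∀ {k : ℕ} {C : ℝ}, k ≤ N + 1 → 0 ≤ C →
      (∀ α : Fin n → ℕ, ∑ i, α i = k → ∀ᵐ x, ‖weakD α u x‖ ≤ C) →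
      ∀ m x, ‖iteratedFDeriv ℝ k (v m) x‖ ≤ n ^ k * C := by
    intro k C hk hC0 hC m x
    refine norm_multilinear_le _ (fun f => ?_) hC0
    rw [iteratedFDeriv_single_eq_partialD (contDiff_infty.1 (hv m) k),
      partialD_convolution (φ m).contDiff_normed (φ m).hasCompactSupport_normed
        (hu.hasWeakDeriv (by rw [sum_countIdx]; exact hk))]
    exact norm_convolution_le_of_ae_le _ (hC _ (sum_countIdx f)) x
  have hbound : ∀ k, ∃ B : ℝ, k ≤ N + 1 → ∀ m x, ‖iteratedFDeriv ℝ k (v m) x‖ ≤ B := by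
    intro k
    by_cases hk : k ≤ N + 1
    · refine ⟨n ^ k * ∑ α ∈ Finset.piAntidiag (Finset.univ : Finset (Fin n)) k,
        (eLpNorm (weakD α u) ∞ volume).toReal, fun _ => hder hk (by positivity) fun α hα => ?_⟩
      filter_upwards [ae_norm_le_of_memLp_top (hu.memLp_weakD (hα.le.trans hk))] with x hx
      exact hx.trans (Finset.single_le_sum
        (f := fun α => (eLpNorm (weakD α u) ∞ volume).toReal) (fun _ _ => by positivity)
        (by simp [hα]))
    · exact ⟨0, fun h => absurd h hk⟩
  choose B hB using hbound
  obtain ⟨h1, h2⟩ := contDiff_of_tendsto_of_bounded N hv (fun k _ hk => hB k hk) hlim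
  refine ⟨h1, fun x y => ?_⟩
  have h3 : Tendsto (fun m => ∑ k ∈ Finset.range (N + 1), (k.factorial : ℝ)⁻¹ •
      iteratedFDeriv ℝ k (v m) x fun _ => y - x) atTop (𝓝 (∑ k ∈ Finset.range (N + 1),
      (k.factorial : ℝ)⁻¹ • iteratedFDeriv ℝ k u x fun _ => y - x)) := by
    refine tendsto_finsetSum _ fun k hk => Tendsto.const_smul ?_ _
    have hk' : k ≤ N := by simpa [Nat.lt_succ_iff] using hk
    exact ((ContinuousMultilinearMap.apply ℝ (fun _ : Fin k => E n) ℂ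
      fun _ => y - x).continuous.tendsto _).comp (h2 k hk' x)
  refine le_of_tendsto ((hlim y).sub h3).norm (Eventually.of_forall fun m => ?_)
  exact norm_sub_taylor_le (contDiff_infty.1 (hv m) _)
    (hder le_rfl ENNReal.toReal_nonneg (fun α hα => hu.ae_norm_weakD_le hα) m) x y

end Sobolev

/-! ### Lattice sums and Riemann sums -/

section Lattice

variable {n : ℕ}

/-- The corner of the unit cube of the integer lattice that contains `s`. -/
def latticeFloor (s : E n) : Fin n → ℤ := fun i => ⌊s i⌋

theorem measurable_latticeFloor : Measurable (latticeFloor : E n → Fin n → ℤ) := by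
  refine measurable_pi_lambda _ fun i => Int.measurable_floor.comp ?_
  fun_prop

/-- Each unit cube has volume one. -/
theorem map_latticeFloor_volume :
    Measure.map (latticeFloor : E n → Fin n → ℤ) volume = Measure.count := by
  refine Measure.ext_of_singleton fun j => ?_
  rw [Measure.map_apply measurable_latticeFloor (measurableSet_singleton _),
    Measure.count_singleton]
  have h : (latticeFloor : E n → Fin n → ℤ) ⁻¹' {j} =
      (WithLp.ofLp : E n → Fin n → ℝ) ⁻¹'
        (Set.pi Set.univ fun i => Set.Ico (j i : ℝ) (j i + 1)) := by
    ext s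
    simp [latticeFloor, funext_iff, Int.floor_eq_iff]
  rw [h, (PiLp.volume_preserving_ofLp (Fin n)).measure_preimage
    (MeasurableSet.univ_pi fun _ => measurableSet_Ico).nullMeasurableSet, volume_pi_pi]
  simp

theorem integrable_comp_latticeFloor_iff {F : Type*} [NormedAddCommGroup F]
    {H : (Fin n → ℤ) → F} (hH : StronglyMeasurable H) :
    Integrable (fun s : E n => H (latticeFloor s)) volume ↔ Summable fun j => ‖H j‖ := by
  rw [← integrable_count_iff, ← map_latticeFloor_volume,
    integrable_map_measure hH.aestronglyMeasurable measurable_latticeFloor.aemeasurable]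
  rfl

theorem integral_comp_latticeFloor {F : Type*} [NormedAddCommGroup F] [NormedSpace ℝ F]
    [CompleteSpace F] {H : (Fin n → ℤ) → F} (hH : StronglyMeasurable H)
    (hs : Summable fun j => ‖H j‖) :
    ∫ s : E n, H (latticeFloor s) = ∑' j, H j := by
  rw [← integral_map (φ := latticeFloor) measurable_latticeFloor.aemeasurable
    hH.aestronglyMeasurable, map_latticeFloor_volume,
    integral_countable (integrable_count_iff.2 hs)]
  simp [Measure.real]

theorem norm_sub_latticeFloor_le (s : E n) : ‖s - intPt (latticeFloor s)‖ ≤ n := by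
  rw [EuclideanSpace.norm_eq, Real.sqrt_le_left (by positivity)]
  calc ∑ i, ‖(s - intPt (latticeFloor s)) i‖ ^ 2 ≤ ∑ _i : Fin n, (1 : ℝ) := by
        refine Finset.sum_le_sum fun i _ => ?_
        have h : (s - intPt (latticeFloor s)) i = Int.fract (s i) := by
          simp [intPt, latticeFloor]
        rw [h, Real.norm_eq_abs, sq_abs]
        exact pow_le_one₀ (Int.fract_nonneg _) (Int.fract_lt_one _).le
    _ = n := by simp
    _ ≤ (n : ℝ) ^ 2 := by
        exact_mod_cast Nat.le_self_pow two_ne_zero n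

theorem integrable_one_add_norm_rpow {q : ℝ} (hq : (n : ℝ) < q) :
    Integrable (fun t : E n => (1 + ‖t‖) ^ (-q)) volume :=
  integrable_one_add_norm (by simpa using hq)

/-- Lattice sums of a power of `1 + ‖·‖` are bounded uniformly in the position of the lattice. -/
theorem exists_tsum_one_add_norm_rpow_le {q : ℝ} (hq : (n : ℝ) < q) :
    ∃ M : ℝ, 0 ≤ M ∧ ∀ z : E n, (Summable fun j : Fin n → ℤ => (1 + ‖z - intPt j‖) ^ (-q)) ∧
      ∑' j : Fin n → ℤ, (1 + ‖z - intPt j‖) ^ (-q) ≤ M := by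
  have hq0 : 0 < q := (Nat.cast_nonneg n).trans_lt hq
  have hI := integrable_one_add_norm_rpow hq
  refine ⟨∫ s : E n, (1 + (n : ℝ)) ^ q * (1 + ‖s‖) ^ (-q),
    integral_nonneg fun s => by positivity, fun z => ?_⟩
  have hle : ∀ s : E n, (1 + ‖z - intPt (latticeFloor s)‖) ^ (-q) ≤
      (1 + (n : ℝ)) ^ q * (1 + ‖z - s‖) ^ (-q) := by
    intro s
    have h1 : 1 + ‖z - s‖ ≤ (1 + n) * (1 + ‖z - intPt (latticeFloor s)‖) := by
      have h2 : z - s = (z - intPt (latticeFloor s)) - (s - intPt (latticeFloor s)) := by abel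
      have h3 := norm_sub_le (z - intPt (latticeFloor s)) (s - intPt (latticeFloor s))
      rw [← h2] at h3
      have h4 := norm_sub_latticeFloor_le s
      have h5 : 0 ≤ (n : ℝ) * ‖z - intPt (latticeFloor s)‖ := by positivity
      linarith
    rw [Real.rpow_neg (by positivity), Real.rpow_neg (by positivity), ← div_eq_mul_inv,
      inv_eq_one_div, div_le_div_iff₀ (by positivity) (by positivity), one_mul,
      ← Real.mul_rpow (by positivity) (by positivity)]
    exact Real.rpow_le_rpow (by positivity) h1 hq0.le
  have hI2 : Integrable (fun s : E n => (1 + (n : ℝ)) ^ q * (1 + ‖z - s‖) ^ (-q)) volume :=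
    (hI.const_mul ((1 + (n : ℝ)) ^ q)).comp_sub_left z
  have hH : StronglyMeasurable fun j : Fin n → ℤ => (1 + ‖z - intPt j‖) ^ (-q) :=
    (measurable_of_countable _).stronglyMeasurable
  have hI3 : Integrable (fun s : E n => (1 + ‖z - intPt (latticeFloor s)‖) ^ (-q)) volume := by
    refine hI2.mono' ((hH.comp_measurable measurable_latticeFloor).aestronglyMeasurable) ?_
    refine Eventually.of_forall fun s => ?_
    rw [Real.norm_eq_abs, abs_of_nonneg (by positivity)]
    exact hle s
  have hs := (integrable_comp_latticeFloor_iff hH).1 hI3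
  have hs' : Summable fun j : Fin n → ℤ => (1 + ‖z - intPt j‖) ^ (-q) := hs.of_norm
  refine ⟨hs', ?_⟩
  rw [← integral_comp_latticeFloor hH hs,
    ← integral_sub_left_eq_self (fun s : E n => (1 + (n : ℝ)) ^ q * (1 + ‖s‖) ^ (-q)) volume z]
  exact integral_mono hI3 hI2 hle

/-- A continuous function with decay of order `p` has, at small scales, an oscillation that is
small relative to any decay of lower order. -/
theorem exists_oscillation_le {g : E n → ℂ} {C p q : ℝ} (hg : Continuous g)
    (hgC : ∀ t, ‖g t‖ ≤ C * (1 + ‖t‖) ^ (-p)) (hq : 0 ≤ q) (hqp : q < p) {ε : ℝ} (hε : 0 < ε) :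
    ∃ ρ > 0, ∀ s t, ‖s - t‖ ≤ ρ → ‖g s - g t‖ ≤ ε * (1 + ‖t‖) ^ (-q) := by
  have hC : 0 ≤ C := by simpa using (norm_nonneg _).trans (hgC 0)
  have hp : 0 < p := hq.trans_lt hqp
  have hdec : ∀ {r : ℝ}, 0 < r → Tendsto (fun x : ℝ => (1 + x) ^ (-r)) atTop (𝓝 0) := fun hr =>
    (tendsto_rpow_neg_atTop hr).comp (tendsto_atTop_add_const_left _ _ tendsto_id)
  have hg0 : Tendsto g (cocompact (E n)) (𝓝 0) := by
    refine squeeze_zero_norm hgC ?_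
    have := ((hdec hp).comp (tendsto_norm_cocompact_atTop (E := E n))).const_mul C
    simpa using this
  have huc := hg.uniformContinuous_of_tendsto_cocompact hg0
  -- outside the ball of radius `R` the decay of order `p` suffices
  obtain ⟨R, hR⟩ := eventually_atTop.1 (((hdec (sub_pos.2 hqp)).const_mul
    (C * 2 ^ p + C)).eventually_lt_const (by simpa using hε))
  set R' := max R 0
  obtain ⟨ρ, hρ, hρ'⟩ := Metric.uniformContinuous_iff.1 huc (ε * (1 + R') ^ (-q))
    (by positivity)
  refine ⟨min 1 (ρ / 2), by positivity, fun s t hst => ?_⟩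
  rcases le_or_gt R' ‖t‖ with hRt | hRt
  · have h1 : 1 + ‖t‖ ≤ 2 * (1 + ‖s‖) := by
      have h2 := norm_sub_norm_le t s
      rw [norm_sub_rev] at h2
      have h3 := hst.trans (min_le_left _ _)
      linarith [norm_nonneg s]
    have h2 : (1 + ‖s‖) ^ (-p) ≤ 2 ^ p * (1 + ‖t‖) ^ (-p) := by
      rw [Real.rpow_neg (by positivity), Real.rpow_neg (by positivity), ← div_eq_mul_inv,
        inv_eq_one_div, div_le_div_iff₀ (by positivity) (by positivity), one_mul,
        ← Real.mul_rpow (by positivity) (by positivity)]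
      exact Real.rpow_le_rpow (by positivity) h1 hp.le
    have h3 := (hR ‖t‖ ((le_max_left _ _).trans hRt)).le
    have h4 : (1 + ‖t‖) ^ (-p) = (1 + ‖t‖) ^ (-(p - q)) * (1 + ‖t‖) ^ (-q) := by
      rw [← Real.rpow_add (by positivity)]
      congr 1
      ring
    calc ‖g s - g t‖ ≤ ‖g s‖ + ‖g t‖ := norm_sub_le _ _
      _ ≤ C * (2 ^ p * (1 + ‖t‖) ^ (-p)) + C * (1 + ‖t‖) ^ (-p) :=
        add_le_add ((hgC s).trans (by gcongr)) (hgC t)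
      _ = ((C * 2 ^ p + C) * (1 + ‖t‖) ^ (-(p - q))) * (1 + ‖t‖) ^ (-q) := by rw [h4]; ring
      _ ≤ _ := by gcongr
  · have h1 : dist s t < ρ := by
      rw [dist_eq_norm]
      exact (hst.trans (min_le_right _ _)).trans_lt (by linarith)
    have h2 := (hρ' h1).le
    rw [dist_eq_norm] at h2
    refine h2.trans ?_
    gcongr ε * ?_
    exact Real.rpow_le_rpow_of_nonpos (by positivity) (by linarith) (by linarith)

/-- The Riemann sums `δ ^ n * ∑ g (δ (z - j))` converge to the integral of `g` as `δ → 0`,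
uniformly in the shift `z`. -/
theorem eventually_riemannSum_close {g : E n → ℂ} {C p : ℝ} (hg : Continuous g)
    (hgC : ∀ t, ‖g t‖ ≤ C * (1 + ‖t‖) ^ (-p)) (hp : (n : ℝ) < p) {ε : ℝ} (hε : 0 < ε) :
    ∀ᶠ δ : ℝ in 𝓝[>] 0, ∀ z : E n,
      (Summable fun j : Fin n → ℤ => g (δ • (z - intPt j))) ∧
      ‖δ ^ n • ∑' j : Fin n → ℤ, g (δ • (z - intPt j)) - ∫ t, g t‖ ≤ ε := by
  obtain ⟨q, hnq, hqp⟩ := exists_between hp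
  have hI := integrable_one_add_norm_rpow hnq
  set I := ∫ t : E n, (1 + ‖t‖) ^ (-q)
  have hI0 : 0 ≤ I := integral_nonneg fun t => by positivity
  have hgI : Integrable g volume :=
    ((integrable_one_add_norm_rpow hp).const_mul C).mono' hg.aestronglyMeasurable
      (Eventually.of_forall hgC)
  obtain ⟨ρ, hρ, hosc⟩ := exists_oscillation_le hg hgC ((Nat.cast_nonneg n).trans hnq.le) hqp
    (ε := ε / (I + 1)) (by positivity)
  have hmem : Set.Ioo (0 : ℝ) (ρ / (n + 1)) ∈ 𝓝[>] (0 : ℝ) :=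
    Ioo_mem_nhdsGT (by positivity)
  filter_upwards [hmem] with δ hδ z
  obtain ⟨hδ0, hδ1⟩ := hδ
  rw [lt_div_iff₀ (by positivity)] at hδ1
  have hscale : ∀ {F : Type} [NormedAddCommGroup F] [NormedSpace ℝ F] (f : E n → F),
      ∫ s, f (δ • (z - s)) = (δ ^ n)⁻¹ • ∫ t, f t := by
    intro F _ _ f
    rw [integral_sub_left_eq_self (fun s => f (δ • s)) volume z, Measure.integral_comp_smul]
    simp [abs_of_pos hδ0]
  have hscaleI : ∀ {F : Type} [NormedAddCommGroup F] (f : E n → F), Integrable f volume →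
      Integrable (fun s => f (δ • (z - s))) volume := fun f hf =>
    (hf.comp_smul hδ0.ne').comp_sub_left z
  set H : (Fin n → ℤ) → ℂ := fun j => g (δ • (z - intPt j))
  have hH : StronglyMeasurable H := (measurable_of_countable _).stronglyMeasurable
  -- the lattice point `latticeFloor s` is at distance at most `n` from `s`, hence `δ n ≤ ρ`
  have hdiff : ∀ s, ‖H (latticeFloor s) - g (δ • (z - s))‖ ≤
      ε / (I + 1) * (1 + ‖δ • (z - s)‖) ^ (-q) := by
    intro s
    refine hosc _ _ ?_
    rw [← smul_sub, sub_sub_sub_cancel_left, norm_smul, Real.norm_eq_abs, abs_of_pos hδ0]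
    have := norm_sub_latticeFloor_le s
    nlinarith
  have hbI : Integrable (fun s => ε / (I + 1) * (1 + ‖δ • (z - s)‖) ^ (-q)) volume :=
    (hscaleI _ hI).const_mul _
  have hdI : Integrable (fun s => H (latticeFloor s) - g (δ • (z - s))) volume := by
    refine hbI.mono' ?_ (Eventually.of_forall hdiff)
    exact (hH.comp_measurable measurable_latticeFloor).aestronglyMeasurable.sub
      (hscaleI _ hgI).aestronglyMeasurable
  have hHI : Integrable (fun s => H (latticeFloor s)) volume := by
    exact (hdI.add (hscaleI _ hgI)).congr (Eventually.of_forall fun s => by simp)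
  have hs := (integrable_comp_latticeFloor_iff hH).1 hHI
  refine ⟨hs.of_norm, ?_⟩
  have h1 : ∑' j, H j - (δ ^ n)⁻¹ • ∫ t, g t = ∫ s, (H (latticeFloor s) - g (δ • (z - s))) := by
    rw [integral_sub hHI (hscaleI _ hgI), integral_comp_latticeFloor hH hs, hscale]
  have h2 : ‖∑' j, H j - (δ ^ n)⁻¹ • ∫ t, g t‖ ≤ ε / (I + 1) * ((δ ^ n)⁻¹ * I) := by
    rw [h1]
    refine (norm_integral_le_of_norm_le hbI (Eventually.of_forall hdiff)).trans_eq ?_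
    rw [integral_const_mul, hscale fun t => (1 + ‖t‖) ^ (-q), smul_eq_mul]
  have hδn : 0 < δ ^ n := by positivity
  have h3 : δ ^ n • ∑' j, H j - ∫ t, g t = δ ^ n • (∑' j, H j - (δ ^ n)⁻¹ • ∫ t, g t) := by
    rw [smul_sub, smul_smul, mul_inv_cancel₀ hδn.ne', one_smul]
  rw [h3, norm_smul, Real.norm_eq_abs, abs_of_pos hδn]
  calc δ ^ n * ‖∑' j, H j - (δ ^ n)⁻¹ • ∫ t, g t‖
      ≤ δ ^ n * (ε / (I + 1) * ((δ ^ n)⁻¹ * I)) := by gcongr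
    _ = ε * (I / (I + 1)) := by field_simp
    _ ≤ ε * 1 := by gcongr; rw [div_le_one (by positivity)]; linarith
    _ = ε := mul_one _

end Lattice

/-! ### Moments -/

section Moments

variable {n : ℕ}

theorem norm_prod_apply_le {k : ℕ} (f : Fin k → Fin n) (t : E n) :
    ‖∏ i, t (f i)‖ ≤ ‖t‖ ^ k := by
  rw [norm_prod]
  calc ∏ i, ‖t (f i)‖ ≤ ∏ _i : Fin k, ‖t‖ :=
        Finset.prod_le_prod (fun _ _ => norm_nonneg _) fun i _ => PiLp.norm_apply_le _ _
    _ = ‖t‖ ^ k := by simp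

theorem pow_mul_rpow_neg_le {k : ℕ} {K : ℝ} (x : ℝ) (hx : 0 ≤ x) :
    x ^ k * (1 + x) ^ (-K) ≤ (1 + x) ^ (-(K - k)) := by
  have h : (1 + x) ^ (-(K - k)) = (1 + x) ^ k * (1 + x) ^ (-K) := by
    rw [← Real.rpow_natCast, ← Real.rpow_add (by positivity)]
    congr 1
    ring
  rw [h]
  gcongr
  linarith

theorem norm_prod_smul_le {η : E n → ℂ} {C K : ℝ} (hηC : ∀ t, ‖η t‖ ≤ C * (1 + ‖t‖) ^ (-K))
    {k : ℕ} (f : Fin k → Fin n) (t : E n) :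
    ‖(∏ i, t (f i)) • η t‖ ≤ C * (1 + ‖t‖) ^ (-(K - k)) := by
  have hC : 0 ≤ C := by simpa using (norm_nonneg _).trans (hηC 0)
  rw [norm_smul]
  calc _ ≤ ‖t‖ ^ k * (C * (1 + ‖t‖) ^ (-K)) := by
        gcongr
        · exact norm_prod_apply_le f t
        · exact hηC t
    _ = C * (‖t‖ ^ k * (1 + ‖t‖) ^ (-K)) := by ring
    _ ≤ _ := by
        gcongr
        exact pow_mul_rpow_neg_le _ (norm_nonneg _)

/-- The derivatives of `𝓕 η` at the origin are, up to the factor `(-2πi)^k`, the moments of `η`;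
hence the moments of order less than `N` are those of a point mass at the origin. -/
theorem integral_prod_smul_eq {N : ℕ} {η : E n → ℂ} {C K : ℝ} (hη : Continuous η)
    (hηC : ∀ t, ‖η t‖ ≤ C * (1 + ‖t‖) ^ (-K)) (hK : (n : ℝ) + N < K)
    (hmoment : ∀ α : Fin n → ℕ, ∑ i, α i < N → partialD α (fun ξ => 𝓕 η ξ - 1) 0 = 0)
    {k : ℕ} (hk : k < N) (f : Fin k → Fin n) :
    ∫ t, (∏ i, t (f i)) • η t = if k = 0 then 1 else 0 := by
  have hC : 0 ≤ C := by simpa using (norm_nonneg _).trans (hηC 0)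
  have hint : ∀ m : ℕ, m ≤ N → Integrable (fun v : E n => ‖v‖ ^ m * ‖η v‖) volume := by
    intro m hm
    have hm' : (m : ℝ) ≤ N := by exact_mod_cast hm
    refine ((integrable_one_add_norm_rpow (q := K - m) (by linarith)).const_mul C).mono'
      (by fun_prop) (Eventually.of_forall fun v => ?_)
    rw [Real.norm_eq_abs, abs_of_nonneg (by positivity)]
    calc _ ≤ ‖v‖ ^ m * (C * (1 + ‖v‖) ^ (-K)) := by gcongr; exact hηC v
      _ = C * (‖v‖ ^ m * (1 + ‖v‖) ^ (-K)) := by ring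
      _ ≤ _ := by
        gcongr
        exact pow_mul_rpow_neg_le _ (norm_nonneg _)
  have hint' : ∀ m : ℕ, (m : ℕ∞) ≤ (N : ℕ∞) →
      Integrable (fun v : E n => ‖v‖ ^ m * ‖η v‖) volume :=
    fun m hm => hint m (by exact_mod_cast hm)
  have hF : ContDiff ℝ k (𝓕 η) :=
    (Real.contDiff_fourier hint').of_le (by exact_mod_cast hk.le)
  have hd := iteratedFDeriv_single_eq_partialD (u := fun ξ => 𝓕 η ξ - 1)
    (hF.sub contDiff_const) f 0
  rw [hmoment _ (by rw [sum_countIdx]; exact hk)] at hd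
  rcases Nat.eq_zero_or_pos k with rfl | hk0
  · simp only [iteratedFDeriv_zero_apply] at hd
    rw [Real.fourier_eq'] at hd
    simp at hd
    simpa [sub_eq_zero] using hd
  · rw [if_neg hk0.ne']
    have h1 : iteratedFDeriv ℝ k (fun ξ => 𝓕 η ξ - 1) 0 = iteratedFDeriv ℝ k (𝓕 η) 0 := by
      have := iteratedFDeriv_sub_apply (x := (0 : E n)) hF.contDiffAt
        (contDiff_const (c := (1 : ℂ))).contDiffAt
      rw [iteratedFDeriv_const_of_ne hk0.ne', Pi.zero_apply, sub_zero] at this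
      exact this
    rw [h1, Real.iteratedFDeriv_fourier hint' hη.aestronglyMeasurable (by exact_mod_cast hk.le),
      Real.fourier_continuousMultilinearMap_apply, Real.fourier_eq'] at hd
    · have h2 : ∀ v : E n, VectorFourier.fourierPowSMulRight (innerSL ℝ) η v k
          (fun i => EuclideanSpace.single (f i) 1) =
          (-(2 * Real.pi * Complex.I)) ^ k * ((∏ i, v (f i)) • η v) := by
        intro v
        rw [VectorFourier.fourierPowSMulRight_apply, smul_eq_mul]
        have h3 : ∀ l : Fin n, innerSL ℝ v (EuclideanSpace.single l 1) = v l := by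
          intro l
          exact (EuclideanSpace.inner_single_right l 1 v).trans (by simp)
        have h4 : ∏ i, innerSL ℝ v (EuclideanSpace.single (f i) 1) = ∏ i, v (f i) :=
          Finset.prod_congr rfl fun i _ => h3 _
        exact congrArg (fun r : ℝ => (-(2 * Real.pi * Complex.I)) ^ k * (r • η v)) h4
      simp only [inner_zero_right, mul_zero, Complex.ofReal_zero, zero_mul, Complex.exp_zero,
        one_smul, h2] at hd
      rw [integral_const_mul] at hd
      refine (mul_eq_zero.1 hd).resolve_left (pow_ne_zero _ ?_)
      simp [Real.pi_ne_zero]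
    · exact VectorFourier.integrable_fourierPowSMulRight _ (hint k hk.le) hη.aestronglyMeasurable

end Moments

/-! ### The interpolation functionals -/

section Interpolation

variable {n N : ℕ}

theorem lam_add (h : ℝ) (j : Fin n → ℤ) (x₀ : E n) (s : StarPts n N) (u v : E n → ℂ) :
    lam h j x₀ s (fun y => u y + v y) = lam h j x₀ s u + lam h j x₀ s v := by
  simp only [lam, smul_add, Finset.sum_add_distrib]
  ring

theorem lam_real_mul (h : ℝ) (j : Fin n → ℤ) (x₀ : E n) (s : StarPts n N) (r : ℝ) (u : E n → ℂ) :
    lam h j x₀ s (fun y => r • u y) = r • lam h j x₀ s u := by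
  simp only [lam, smul_add, Finset.smul_sum, smul_comm r]

theorem lam_sum {ι : Type*} (t : Finset ι) (h : ℝ) (j : Fin n → ℤ) (x₀ : E n) (s : StarPts n N)
    (u : ι → E n → ℂ) :
    lam h j x₀ s (fun y => ∑ i ∈ t, u i y) = ∑ i ∈ t, lam h j x₀ s (u i) := by
  classical
  induction t using Finset.induction_on with
  | empty => simp [lam]
  | insert a t ha ih =>
    simp only [Finset.sum_insert ha]
    rw [lam_add, ih]

/-- The functional reproduces monomials centred at `x₀`: this is `V⁻¹ * V = 1`. -/
theorem lam_monom {h : ℝ} (hh : h ≠ 0) (j : Fin n → ℤ) (x₀ : E n) (s : StarPts n N)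
    (hdet : (vander h x₀ s).det ≠ 0) {β : Fin n → ℕ} (hβ : ∑ i, β i < N) (a : ℂ) :
    lam h j x₀ s (fun y => monom β (h⁻¹ • (y - x₀)) • a) =
      monom β (h⁻¹ • (h • intPt j - x₀)) • a := by
  have hz : h⁻¹ • (h • intPt j - x₀) = intPt j - h⁻¹ • x₀ := by
    rw [smul_sub, smul_smul, inv_mul_cancel₀ hh, one_smul]
  rw [hz]
  have hcomm : ∑ α : multiIdx n N, monom α.1 (intPt j - h⁻¹ • x₀) *
      ∑ k : multiIdx n N, (vander h x₀ s)⁻¹ α k = ∑ k : multiIdx n N, ∑ α : multiIdx n N,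
      (vander h x₀ s)⁻¹ α k * monom α.1 (intPt j - h⁻¹ • x₀) := by
    simp only [Finset.mul_sum]
    rw [Finset.sum_comm]
    exact Finset.sum_congr rfl fun k _ => Finset.sum_congr rfl fun α _ => mul_comm _ _
  rcases Nat.eq_zero_or_pos (∑ i, β i) with h0 | h0
  · have hβ0 : ∀ i, β i = 0 := fun i => (Finset.sum_eq_zero_iff.1 h0) i (Finset.mem_univ i)
    have hm : ∀ y : E n, monom β y = 1 := fun y => by simp [monom, hβ0]
    simp only [lam, hm, one_smul]
    rw [hcomm, ← Finset.sum_smul, ← add_smul, sub_add_cancel, one_smul]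
  · obtain ⟨i, hi⟩ : ∃ i, β i ≠ 0 := by
      by_contra! hc
      simp [hc] at h0
    have hm : monom β (h⁻¹ • (x₀ - x₀)) = 0 := by
      rw [sub_self, smul_zero, monom]
      exact Finset.prod_eq_zero (Finset.mem_univ i) (by simp [hi])
    let b : multiIdx n N := ⟨β, mem_multiIdx.2 ⟨h0, hβ⟩⟩
    have hV : (vander h x₀ s)⁻¹ * vander h x₀ s = 1 :=
      Matrix.nonsing_inv_mul _ (isUnit_iff_ne_zero.2 hdet)
    have hk : ∀ k, monom β (h⁻¹ • (s k - x₀)) = vander h x₀ s k b := fun k => rfl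
    simp only [lam, hm, zero_smul, smul_zero, zero_add, hk, smul_smul]
    rw [← Finset.sum_smul]
    congr 1
    calc _ = ∑ α : multiIdx n N, monom α.1 (intPt j - h⁻¹ • x₀) *
            ((vander h x₀ s)⁻¹ * vander h x₀ s) α b := by
          simp only [Matrix.mul_apply, Finset.sum_mul, Finset.mul_sum]
          rw [Finset.sum_comm]
          exact Finset.sum_congr rfl fun k _ => Finset.sum_congr rfl fun α _ => by ring
      _ = monom β (intPt j - h⁻¹ • x₀) := by
          rw [hV]
          simp [Matrix.one_apply, b]

theorem monom_update_add_one (β : Fin n → ℕ) (i : Fin n) (z : E n) :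
    monom (β + Pi.single i 1) z = monom β z * z i := by
  simp only [monom, Pi.add_apply, pow_add, Finset.prod_mul_distrib]
  congr 1
  rw [Finset.prod_eq_single i]
  · simp
  · intro l _ hl
    simp [hl]
  · simp

/-- The functional reproduces products of fewer than `N` affine factors with any centre `x`. The
factors are rewritten one after the other in terms of `x₀`. -/
theorem lam_monom_mul_prod {h : ℝ} (hh : h ≠ 0) (j : Fin n → ℤ) (x₀ : E n) (s : StarPts n N)
    (hdet : (vander h x₀ s).det ≠ 0) (x : E n) (a : ℂ) {k : ℕ} (f : Fin k → Fin n)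
    (β : Fin n → ℕ) (hβ : ∑ i, β i + k < N) :
    lam h j x₀ s (fun y => (monom β (h⁻¹ • (y - x₀)) * ∏ i, (y - x) (f i)) • a) =
      (monom β (h⁻¹ • (h • intPt j - x₀)) * ∏ i, (h • intPt j - x) (f i)) • a := by
  induction k generalizing β with
  | zero => simpa using lam_monom hh j x₀ s hdet (β := β) (by simpa using hβ) a
  | succ k ih =>
    have key : ∀ y : E n, (monom β (h⁻¹ • (y - x₀)) * ∏ i, (y - x) (f i)) • a =
        h • ((monom (β + Pi.single (f 0) 1) (h⁻¹ • (y - x₀)) * ∏ i, (y - x) (Fin.tail f i)) • a) +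
        (x₀ - x) (f 0) • ((monom β (h⁻¹ • (y - x₀)) * ∏ i, (y - x) (Fin.tail f i)) • a) := by
      intro y
      have h1 : (y - x) (f 0) = h * (h⁻¹ • (y - x₀)) (f 0) + (x₀ - x) (f 0) := by
        simp only [PiLp.smul_apply, PiLp.sub_apply, smul_eq_mul]
        rw [mul_inv_cancel_left₀ hh]
        ring
      rw [Fin.prod_univ_succ, h1, monom_update_add_one, smul_smul, smul_smul, ← add_smul]
      congr 1
      simp only [Fin.tail]
      ring
    simp only [key]
    rw [lam_add, lam_real_mul, lam_real_mul, ih (Fin.tail f) _ ?_, ih (Fin.tail f) _ ?_]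
    · omega
    · simp only [Pi.add_apply, Finset.sum_add_distrib, Finset.sum_pi_single']
      simp
      omega

theorem lam_prod {h : ℝ} (hh : h ≠ 0) (j : Fin n → ℤ) (x₀ : E n) (s : StarPts n N)
    (hdet : (vander h x₀ s).det ≠ 0) (x : E n) (a : ℂ) {k : ℕ} (f : Fin k → Fin n) (hk : k < N) :
    lam h j x₀ s (fun y => (∏ i, (y - x) (f i)) • a) = (∏ i, (h • intPt j - x) (f i)) • a := by
  have := lam_monom_mul_prod hh j x₀ s hdet x a f 0 (by simpa using hk)
  simpa [monom] using this

theorem abs_monom_le {α : Fin n → ℕ} (hα : ∑ i, α i ≤ N) {r : ℝ} {x : E n} (hx : ‖x‖ ≤ r) :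
    |monom α x| ≤ (1 + r) ^ N := by
  have hr : 0 ≤ r := (norm_nonneg _).trans hx
  rw [monom, Finset.abs_prod]
  calc ∏ i, |x i ^ α i| ≤ ∏ i, (1 + r) ^ α i := by
        refine Finset.prod_le_prod (fun _ _ => abs_nonneg _) fun i _ => ?_
        rw [abs_pow]
        have : |x i| ≤ 1 + r := (PiLp.norm_apply_le x i).trans (by linarith)
        gcongr
    _ = (1 + r) ^ ∑ i, α i := Finset.prod_pow_eq_pow_sum _ _ _
    _ ≤ _ := pow_le_pow_right₀ (by linarith) hα

/-- Cramer's rule bounds the entries of an inverse matrix in terms of its determinant. -/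
theorem abs_inv_apply_le {ι : Type*} [Fintype ι] [DecidableEq ι] (A : Matrix ι ι ℝ) {b c : ℝ}
    (hb : 1 ≤ b) (hA : ∀ i k, |A i k| ≤ b) (hc : 0 < c) (hdet : c ≤ |A.det|) (i k : ι) :
    |A⁻¹ i k| ≤ c⁻¹ * ((Fintype.card ι).factorial * b ^ Fintype.card ι) := by
  rw [Matrix.inv_def, Matrix.smul_apply, smul_eq_mul, abs_mul, Ring.inverse_eq_inv', abs_inv,
    Matrix.adjugate_apply]
  gcongr
  have h := Matrix.det_le (A := A.updateRow k (Pi.single i 1)) (abv := AbsoluteValue.abs) (x := b)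
    fun l m => by
      rw [AbsoluteValue.abs_apply, Matrix.updateRow_apply]
      split_ifs
      · rw [Pi.single_apply]
        split_ifs
        · simpa using hb
        · simpa using zero_le_one.trans hb
      · exact hA l m
  simpa [nsmul_eq_mul] using h

/-- The lower bound for the Vandermonde determinant bounds the entries of the inverse, and hence
the coefficients of the functional, by Cramer's rule. -/
theorem exists_norm_lam_le (n N : ℕ) (κ₁ κ₂ c : ℝ) (hκ₁ : 0 < κ₁) (hκ₂ : 0 < κ₂) (hc : 0 < c) :
    ∃ L : ℝ, 0 ≤ L ∧ ∀ (h : ℝ) (j : Fin n → ℤ) (x₀ : E n) (s : StarPts n N),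
      ‖intPt j - h⁻¹ • x₀‖ ≤ κ₁ → (∀ k, ‖h⁻¹ • (s k - x₀)‖ ≤ κ₂) → c ≤ |(vander h x₀ s).det| →
      ∀ (v : E n → ℂ) (B : ℝ), ‖v x₀‖ ≤ B → (∀ k, ‖v (s k)‖ ≤ B) → ‖lam h j x₀ s v‖ ≤ L * B := by
  set m := Fintype.card (multiIdx n N)
  set b := c⁻¹ * (m.factorial * ((1 + κ₂) ^ N) ^ m)
  set Q := (1 + κ₁) ^ N
  refine ⟨(1 + m * (Q * (m * b))) + m * (m * (b * Q)), by positivity, ?_⟩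
  intro h j x₀ s hx₀ hs hdet v B hv0 hvs
  have hmon : ∀ α : multiIdx n N, |monom α.1 (intPt j - h⁻¹ • x₀)| ≤ Q := fun α =>
    abs_monom_le (mem_multiIdx.1 α.2).2.le hx₀
  have hinv : ∀ α k, |(vander h x₀ s)⁻¹ α k| ≤ b := fun α k =>
    abs_inv_apply_le _ (one_le_pow₀ (by linarith))
      (fun k α => abs_monom_le (mem_multiIdx.1 α.2).2.le (hs k)) hc hdet α k
  have hB : 0 ≤ B := (norm_nonneg _).trans hv0
  have h1 : |1 - ∑ α : multiIdx n N, monom α.1 (intPt j - h⁻¹ • x₀) *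
      ∑ k : multiIdx n N, (vander h x₀ s)⁻¹ α k| ≤ 1 + m * (Q * (m * b)) := by
    refine (abs_sub _ _).trans ?_
    rw [abs_one]
    gcongr
    refine (Finset.abs_sum_le_sum_abs _ _).trans ((Finset.sum_le_card_nsmul _ _ (Q * (m * b))
      fun α _ => ?_).trans_eq (by simp [m]))
    rw [abs_mul]
    gcongr
    · exact hmon α
    · exact (Finset.abs_sum_le_sum_abs _ _).trans ((Finset.sum_le_card_nsmul _ _ b
        fun k _ => hinv α k).trans_eq (by simp [m]))
  have h2 : ∀ k, |∑ α : multiIdx n N, (vander h x₀ s)⁻¹ α k * monom α.1 (intPt j - h⁻¹ • x₀)| ≤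
      m * (b * Q) := by
    intro k
    refine (Finset.abs_sum_le_sum_abs _ _).trans ((Finset.sum_le_card_nsmul _ _ (b * Q)
      fun α _ => ?_).trans_eq (by simp [m]))
    rw [abs_mul]
    gcongr
    · exact hinv α k
    · exact hmon α
  rw [lam, add_mul]
  refine (norm_add_le _ _).trans (add_le_add ?_ ?_)
  · rw [norm_smul, Real.norm_eq_abs]
    gcongr
  · refine (norm_sum_le _ _).trans ((Finset.sum_le_card_nsmul _ _ (m * (b * Q) * B)
      fun k _ => ?_).trans_eq (by simp [m]; ring))
    rw [norm_smul, Real.norm_eq_abs]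
    gcongr
    · exact h2 k
    · exact hvs k

end Interpolation

/-! ### The two parts of the error -/

section Estimate

variable {n N : ℕ}

/-- The Taylor polynomial of `u` at `x` of degree less than `N`, as a function of `y`. -/
def taylorPoly (N : ℕ) (u : E n → ℂ) (x y : E n) : ℂ :=
  ∑ k ∈ Finset.range N, (k.factorial : ℝ)⁻¹ • iteratedFDeriv ℝ k u x fun _ => y - x

/-- The coefficient of `∏ i, (y - x) (f i)` in the Taylor polynomial. -/
def taylorCoeff {k : ℕ} (u : E n → ℂ) (x : E n) (f : Fin k → Fin n) : ℂ :=
  (k.factorial : ℝ)⁻¹ • iteratedFDeriv ℝ k u x fun i => EuclideanSpace.single (f i) 1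

theorem taylorPoly_eq (u : E n → ℂ) (x y : E n) :
    taylorPoly N u x y = ∑ k ∈ Finset.range N, ∑ f : Fin k → Fin n,
      (∏ i, (y - x) (f i)) • taylorCoeff u x f := by
  simp only [taylorPoly, taylorCoeff]
  refine Finset.sum_congr rfl fun k _ => ?_
  rw [multilinear_apply_eq_sum, Finset.smul_sum]
  exact Finset.sum_congr rfl fun f _ => smul_comm _ _ _

theorem norm_taylorCoeff_le {k : ℕ} {u : E n → ℂ} (hu : ContDiff ℝ k u) (x : E n)
    (f : Fin k → Fin n) : ‖taylorCoeff u x f‖ ≤ gradNorm k u x := by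
  rw [taylorCoeff, norm_smul, norm_inv, Real.norm_natCast]
  refine (mul_le_of_le_one_left (norm_nonneg _) (inv_le_one_of_one_le₀ ?_)).trans
    (norm_iteratedFDeriv_single_le_gradNorm hu f x)
  exact_mod_cast k.factorial_pos

/-- The functional reproduces the Taylor polynomial at the grid point. -/
theorem lam_taylorPoly {h : ℝ} (hh : h ≠ 0) (j : Fin n → ℤ) (x₀ : E n) (s : StarPts n N)
    (hdet : (vander h x₀ s).det ≠ 0) (u : E n → ℂ) (x : E n) :
    lam h j x₀ s (taylorPoly N u x) = taylorPoly N u x (h • intPt j) := by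
  have h1 : taylorPoly N u x = fun y => ∑ k ∈ Finset.range N, ∑ f : Fin k → Fin n,
      (∏ i, (y - x) (f i)) • taylorCoeff u x f := funext fun y => taylorPoly_eq u x y
  rw [h1, lam_sum]
  refine Finset.sum_congr rfl fun k hk => ?_
  rw [lam_sum]
  exact Finset.sum_congr rfl fun f _ =>
    lam_prod hh j x₀ s hdet x _ f (Finset.mem_range.1 hk)

/-- If the discrete moments of `η` at scale `δ` are close to those of a point mass, then the
quasi-interpolant of the exact values of the Taylor polynomial is close to `u x`. -/
theorem taylorPoly_sum_close (hn : 1 ≤ n) (hN : 1 ≤ N) {η u : E n → ℂ} {x : E n} {h δ ε : ℝ}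
    (hh : 0 < h) (hδ : 0 < δ) (hε : 0 ≤ ε) (hu : ContDiff ℝ ((N - 1 : ℕ) : ℕ∞) u)
    (hmom : ∀ k < N, ∀ f : Fin k → Fin n, ∀ z : E n,
      (Summable fun j : Fin n → ℤ =>
        (∏ i, (δ • (z - intPt j)) (f i)) • η (δ • (z - intPt j))) ∧
      ‖δ ^ n • ∑' j : Fin n → ℤ, (∏ i, (δ • (z - intPt j)) (f i)) • η (δ • (z - intPt j)) -
        (if k = 0 then 1 else 0)‖ ≤ ε) :
    (Summable fun j : Fin n → ℤ =>
      taylorPoly N u x (h • intPt j) * η (δ • (h⁻¹ • x - intPt j))) ∧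
    ‖δ ^ n • ∑' j : Fin n → ℤ, taylorPoly N u x (h • intPt j) * η (δ • (h⁻¹ • x - intPt j)) -
      u x‖ ≤ n ^ N * ε * ∑ k ∈ Finset.range N, gradNorm k u x * (δ⁻¹ * h) ^ k := by
  set y : (Fin n → ℤ) → E n := fun j => δ • (h⁻¹ • x - intPt j) with hy
  have hyx : ∀ j, h • intPt j - x = (-(δ⁻¹ * h)) • y j := by
    intro j
    simp only [hy, smul_smul, smul_sub, neg_smul, neg_mul]
    have h1 : δ⁻¹ * h * δ = h := by field_simp
    have h2 : δ⁻¹ * h * (δ * h⁻¹) = 1 := by field_simp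
    rw [h1, h2, one_smul]
    abel
  let d : ∀ k : ℕ, (Fin k → Fin n) → ℂ := fun k f => (-(δ⁻¹ * h)) ^ k • taylorCoeff u x f
  have hterm : ∀ j, taylorPoly N u x (h • intPt j) * η (y j) =
      ∑ k ∈ Finset.range N, ∑ f : Fin k → Fin n, d k f * ((∏ i, y j (f i)) • η (y j)) := by
    intro j
    rw [taylorPoly_eq, Finset.sum_mul]
    refine Finset.sum_congr rfl fun k _ => ?_
    rw [Finset.sum_mul]
    refine Finset.sum_congr rfl fun f _ => ?_
    have h1 : ∏ i, (h • intPt j - x) (f i) = (-(δ⁻¹ * h)) ^ k * ∏ i, y j (f i) := by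
      simp only [hyx, PiLp.smul_apply, smul_eq_mul, Finset.prod_mul_distrib, Finset.prod_const,
        Finset.card_univ, Fintype.card_fin]
    rw [h1]
    simp only [d, Complex.real_smul]
    push_cast
    ring
  have hsum : HasSum (fun j => taylorPoly N u x (h • intPt j) * η (y j))
      (∑ k ∈ Finset.range N, ∑ f : Fin k → Fin n,
        d k f * ∑' j, ((∏ i, y j (f i)) • η (y j))) := by
    simp only [hterm]
    refine hasSum_sum fun k hk => hasSum_sum fun f _ => HasSum.mul_left _ ?_
    exact (hmom k (Finset.mem_range.1 hk) f (h⁻¹ • x)).1.hasSum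
  refine ⟨hsum.summable, ?_⟩
  rw [hsum.tsum_eq]
  have hux : u x = ∑ k ∈ Finset.range N, ∑ f : Fin k → Fin n, d k f * (if k = 0 then 1 else 0) := by
    rw [Finset.sum_eq_single_of_mem 0 (Finset.mem_range.2 hN)]
    · simp [d, taylorCoeff]
    · intro k _ hk
      simp [hk]
  have hdiff : δ ^ n • (∑ k ∈ Finset.range N, ∑ f : Fin k → Fin n,
        d k f * ∑' j, ((∏ i, y j (f i)) • η (y j))) - u x =
      ∑ k ∈ Finset.range N, ∑ f : Fin k → Fin n,
        d k f * (δ ^ n • ∑' j, ((∏ i, y j (f i)) • η (y j)) - (if k = 0 then 1 else 0)) := by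
    rw [hux, Finset.smul_sum, ← Finset.sum_sub_distrib]
    refine Finset.sum_congr rfl fun k _ => ?_
    rw [Finset.smul_sum, ← Finset.sum_sub_distrib]
    refine Finset.sum_congr rfl fun f _ => ?_
    rw [mul_sub, mul_smul_comm]
  rw [hdiff, Finset.mul_sum]
  refine norm_sum_le_of_le _ fun k hk => ?_
  have hkN := Finset.mem_range.1 hk
  have hgrad : 0 ≤ gradNorm k u x := Real.sqrt_nonneg _
  calc _ ≤ ∑ _f : Fin k → Fin n, (δ⁻¹ * h) ^ k * gradNorm k u x * ε := by
        refine norm_sum_le_of_le _ fun f _ => ?_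
        rw [norm_mul]
        refine mul_le_mul ?_ (hmom k hkN f (h⁻¹ • x)).2 (norm_nonneg _) (by positivity)
        simp only [d]
        rw [norm_smul, norm_pow, norm_neg, Real.norm_eq_abs, abs_of_pos (by positivity)]
        gcongr
        refine norm_taylorCoeff_le (hu.of_le ?_) x f
        exact_mod_cast Nat.le_sub_one_of_lt hkN
    _ = n ^ k * ε * (gradNorm k u x * (δ⁻¹ * h) ^ k) := by simp; ring
    _ ≤ n ^ N * ε * (gradNorm k u x * (δ⁻¹ * h) ^ k) := by
        have : (n : ℝ) ^ k ≤ n ^ N := pow_le_pow_right₀ (by exact_mod_cast hn) hkN.le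
        gcongr

/-- Functions of size `‖y - x‖ ^ N` contribute terms that decay like `(1 + ‖z - j‖) ^ (N - K)`,
where `z = x / h`. -/
theorem norm_lam_mul_le {η R : E n → ℂ} {C₀ K κ₁ κ₂ L S h δ : ℝ} (hκ₁ : 0 < κ₁) (hκ₂ : 0 < κ₂)
    (hL : 0 ≤ L) (hS : 0 ≤ S) (hh : 0 < h) (hδ : 0 < δ) (hδ1 : δ ≤ 1) (hK : 0 ≤ K)
    (hηC : ∀ t, ‖η t‖ ≤ C₀ * (1 + ‖t‖) ^ (-K)) {j : Fin n → ℤ} {x x₀ : E n} {s : StarPts n N}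
    (hx₀ : dist x₀ (h • intPt j) ≤ h * κ₁) (hs : ∀ k, dist (s k) x₀ ≤ h * κ₂)
    (hR : ∀ y, ‖R y‖ ≤ S * ‖y - x‖ ^ N)
    (hlam : ∀ B : ℝ, ‖R x₀‖ ≤ B → (∀ k, ‖R (s k)‖ ≤ B) → ‖lam h j x₀ s R‖ ≤ L * B) :
    ‖lam h j x₀ s R * η (δ • (h⁻¹ • x - intPt j))‖ ≤
      L * (1 + κ₁ + κ₂) ^ N * C₀ * δ ^ (-K) * S * h ^ N *
        (1 + ‖h⁻¹ • x - intPt j‖) ^ (-(K - N)) := by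
  set w := h⁻¹ • x - intPt j with hw
  have hC : 0 ≤ C₀ := by simpa using (norm_nonneg _).trans (hηC 0)
  have hjx : ‖h • intPt j - x‖ = h * ‖w‖ := by
    have : h • intPt j - x = (-h) • w := by
      rw [hw, smul_sub, smul_smul, neg_mul, mul_inv_cancel₀ hh.ne']
      simp only [neg_smul, one_smul]
      abel
    rw [this, norm_smul, norm_neg, Real.norm_eq_abs, abs_of_pos hh]
  have hbase : κ₁ + κ₂ + ‖w‖ ≤ (1 + κ₁ + κ₂) * (1 + ‖w‖) := by nlinarith [norm_nonneg w]
  have h1 : ‖x₀ - x‖ ≤ h * κ₁ + h * ‖w‖ := by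
    rw [← hjx]
    calc ‖x₀ - x‖ = ‖(x₀ - h • intPt j) + (h • intPt j - x)‖ := by congr 1; abel
      _ ≤ _ := (norm_add_le _ _).trans (by rw [← dist_eq_norm x₀]; gcongr)
  have hfar : ∀ y : E n, ‖y - x‖ ≤ h * (κ₁ + κ₂ + ‖w‖) →
      ‖R y‖ ≤ S * (h * ((1 + κ₁ + κ₂) * (1 + ‖w‖))) ^ N := fun y hyx =>
    (hR y).trans (by gcongr; exact hyx.trans (by gcongr))
  have hB := hlam (S * (h * ((1 + κ₁ + κ₂) * (1 + ‖w‖))) ^ N)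
    (hfar _ (h1.trans (by nlinarith [mul_pos hh hκ₂])))
    (fun k => hfar _ (by
      have h2 : ‖s k - x‖ ≤ ‖s k - x₀‖ + ‖x₀ - x‖ := norm_sub_le_norm_sub_add_norm_sub _ _ _
      have h3 := hs k
      rw [dist_eq_norm] at h3
      linarith))
  have hη' : ‖η (δ • w)‖ ≤ C₀ * (δ ^ (-K) * (1 + ‖w‖) ^ (-K)) := by
    refine (hηC _).trans ?_
    rw [← Real.mul_rpow hδ.le (by positivity)]
    gcongr C₀ * ?_
    refine Real.rpow_le_rpow_of_nonpos (by positivity) ?_ (by linarith)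
    rw [norm_smul, Real.norm_eq_abs, abs_of_pos hδ]
    linarith
  have hpow : (1 + ‖w‖) ^ (-(K - N)) = (1 + ‖w‖) ^ N * (1 + ‖w‖) ^ (-K) := by
    rw [← Real.rpow_natCast, ← Real.rpow_add (by positivity)]
    congr 1
    ring
  rw [norm_mul]
  calc _ ≤ L * (S * (h * ((1 + κ₁ + κ₂) * (1 + ‖w‖))) ^ N) *
        (C₀ * (δ ^ (-K) * (1 + ‖w‖) ^ (-K))) := by gcongr
    _ = _ := by rw [hpow]; simp only [mul_pow]; ring

end Estimate

end QuasiInterp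

end

open QuasiInterp Filter Topology in
theorem mainTheorem1 (n N : ℕ) (hn : 1 ≤ n) (hN : 1 ≤ N)
    (K : ℝ) (hK : (n : ℝ) + N < K)
    (n₀ : ℕ) (hn₀ : IsLeast {m : ℕ | (n : ℝ) / 2 < m} n₀)
    (η : QuasiInterp.E n → ℂ) (hη : ContDiff ℝ n₀ η)
    (hdecay : ∀ β : Fin n → ℕ, ∑ i, β i ≤ n₀ →
      ∃ C : ℝ, ∀ x, (1 + ‖x‖) ^ K * ‖QuasiInterp.partialD β η x‖ ≤ C)
    (hmoment : ∀ α : Fin n → ℕ, ∑ i, α i < N →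
      QuasiInterp.partialD α (fun ξ => 𝓕 η ξ - 1) 0 = 0)
    (ε : ℝ) (hε : 0 < ε) :
    ∃ D : ℝ, 0 < D ∧
      ∀ κ₁ κ₂ c : ℝ, ∃ C : ℝ,
        ∀ (h : ℝ) (X : Set (QuasiInterp.E n))
          (xt : (Fin n → ℤ) → QuasiInterp.E n)
          (st : (Fin n → ℤ) → QuasiInterp.StarPts n N),
          QuasiInterp.NearGrid X h κ₁ →
          QuasiInterp.StarSystem X h κ₂ c xt st →
          ∀ u : QuasiInterp.E n → ℂ, Continuous u → QuasiInterp.MemSobolevInf N u →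
            ContDiff ℝ ((N - 1 : ℕ) : ℕ∞) u ∧
            ∀ x : QuasiInterp.E n,
              Summable (QuasiInterp.summand η D h xt st u x) ∧
              ‖QuasiInterp.quasi η D h xt st u x - u x‖ ≤
                C * h ^ N * QuasiInterp.supGrad N u +
                ε * ∑ k ∈ Finset.range N,
                  QuasiInterp.gradNorm k u x * (Real.sqrt D * h) ^ k := by
  have hηc : Continuous η := hη.continuous
  have hK0 : 0 < K := by
    have : (0 : ℝ) ≤ n + N := by positivity
    linarith
  obtain ⟨C₀, hC₀⟩ := hdecay 0 (by simp)
  have hηC : ∀ t, ‖η t‖ ≤ C₀ * (1 + ‖t‖) ^ (-K) := by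
    intro t
    have h1 := hC₀ t
    rw [partialD_of_sum_eq_zero (by simp)] at h1
    rw [Real.rpow_neg (by positivity), ← div_eq_mul_inv, le_div_iff₀ (by positivity), mul_comm]
    exact h1
  have hC₀0 : 0 ≤ C₀ := by simpa using (norm_nonneg _).trans (hηC 0)
  -- there are at most `n ^ N` sequences of coordinates of each length `k < N`
  set ε' := ε / n ^ N with hε'
  have hnN : (0 : ℝ) < n ^ N := by
    have : (0 : ℝ) < n := by exact_mod_cast hn
    positivity
  have hε'0 : 0 < ε' := by positivity
  have hev : ∀ᶠ δ : ℝ in 𝓝[>] 0, ∀ k ∈ Finset.range N, ∀ f : Fin k → Fin n, ∀ z : E n,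
      (Summable fun j : Fin n → ℤ =>
        (∏ i, (δ • (z - intPt j)) (f i)) • η (δ • (z - intPt j))) ∧
      ‖δ ^ n • ∑' j : Fin n → ℤ, (∏ i, (δ • (z - intPt j)) (f i)) • η (δ • (z - intPt j)) -
        (if k = 0 then 1 else 0)‖ ≤ ε' := by
    refine (Finset.eventually_all _).2 fun k hk => eventually_all.2 fun f => ?_
    have hkN := Finset.mem_range.1 hk
    have hkN' : (k : ℝ) ≤ N := by exact_mod_cast hkN.le
    have h1 := eventually_riemannSum_close (g := fun t => (∏ i, t (f i)) • η t)
      (by fun_prop) (fun t => norm_prod_smul_le hηC f t) (by linarith) hε'0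
    rw [integral_prod_smul_eq hηc hηC hK hmoment hkN f] at h1
    exact h1
  obtain ⟨δ, hmom, hδ0, hδ1⟩ :=
    (hev.and (Ioo_mem_nhdsGT (zero_lt_one : (0 : ℝ) < 1))).exists
  have hsqrt : Real.sqrt ((δ ^ 2)⁻¹) = δ⁻¹ := by
    rw [← inv_pow, Real.sqrt_sq (by positivity)]
  have hDn : ((δ ^ 2)⁻¹ : ℝ) ^ (-(n : ℝ) / 2) = δ ^ n := by
    rw [Real.inv_rpow (by positivity), ← Real.rpow_neg (by positivity), ← Real.rpow_natCast δ 2,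
      ← Real.rpow_mul hδ0.le, ← Real.rpow_natCast δ n]
    congr 1
    push_cast
    ring
  -- `D = δ ^ (-2)`, chosen before the constants of the nodes
  refine ⟨(δ ^ 2)⁻¹, by positivity, fun κ₁ κ₂ c => ?_⟩
  by_cases hpos : 0 < κ₁ ∧ 0 < κ₂ ∧ 0 < c
  swap
  -- there are no admissible nodes unless the three constants are positive
  · exact ⟨0, fun h X xt st hX hst => absurd ⟨hX.2.1, hst.κ₂_pos, hst.c_pos⟩ hpos⟩
  obtain ⟨hκ₁, hκ₂, hc⟩ := hpos
  obtain ⟨L, hL, hlam⟩ := exists_norm_lam_le n N κ₁ κ₂ c hκ₁ hκ₂ hc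
  obtain ⟨M, hM, hsumM⟩ := exists_tsum_one_add_norm_rpow_le (n := n) (q := K - N) (by linarith)
  set A := L * (1 + κ₁ + κ₂) ^ N * C₀ * δ ^ (-K)
  have hA : 0 ≤ A := by positivity
  refine ⟨δ ^ n * (A * n ^ N * M), fun h X xt st hX hst u huc hu => ?_⟩
  have hh : 0 < h := hX.1
  have hreg : ContDiff ℝ ((N - 1 : ℕ) : ℕ∞) u ∧ ∀ x y, ‖u y - taylorPoly N u x y‖ ≤
      n ^ N * supGrad N u * ‖y - x‖ ^ N := by
    obtain ⟨N', rfl⟩ : ∃ N', N = N' + 1 := ⟨N - 1, by omega⟩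
    exact hu.contDiff_and_taylor huc
  refine ⟨hreg.1, fun x => ?_⟩
  have hS : 0 ≤ n ^ N * supGrad N u := mul_nonneg hnN.le ENNReal.toReal_nonneg
  have hdet : ∀ j, (vander h (xt j) (st j)).det ≠ 0 := fun j hj => by
    have := hst.det_ge j
    rw [hj, abs_zero] at this
    linarith
  have hxt : ∀ j, dist (xt j) (h • intPt j) ≤ h * κ₁ := by
    intro j
    obtain ⟨y, hyX, hyb⟩ := hX.2.2 j
    exact (hst.node_closest j y hyX).trans (Metric.mem_ball.1 hyb).le
  have hst' : ∀ j k, dist (st j k) (xt j) ≤ h * κ₂ := fun j k =>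
    (Metric.mem_ball.1 (hst.star_ball j k)).le
  have hscaled : ∀ {a : ℝ} (v : E n), ‖v‖ ≤ h * a → ‖h⁻¹ • v‖ ≤ a := by
    intro a v hv
    rw [norm_smul, norm_inv, Real.norm_eq_abs, abs_of_pos hh, inv_mul_le_iff₀ hh]
    exact hv
  have hrem : ∀ j, ‖lam h j (xt j) (st j) (fun y => u y - taylorPoly N u x y) *
      η (δ • (h⁻¹ • x - intPt j))‖ ≤ A * (n ^ N * supGrad N u) * h ^ N *
        (1 + ‖h⁻¹ • x - intPt j‖) ^ (-(K - N)) := by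
    intro j
    refine norm_lam_mul_le (R := fun y => u y - taylorPoly N u x y) hκ₁ hκ₂ hL hS hh hδ0 hδ1.le hK0.le hηC (hxt j) (hst' j)
      (hreg.2 x) (hlam h j (xt j) (st j) ?_ (fun k => ?_) (hst.det_ge j)
        fun y => u y - taylorPoly N u x y)
    · have h1 : intPt j - h⁻¹ • xt j = h⁻¹ • (h • intPt j - xt j) := by
        rw [smul_sub, smul_smul, inv_mul_cancel₀ hh.ne', one_smul]
      rw [h1]
      refine hscaled _ ?_
      rw [← dist_eq_norm, dist_comm]
      exact hxt j
    · refine hscaled _ ?_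
      rw [← dist_eq_norm]
      exact hst' j k
  obtain ⟨hs1, hclose⟩ := taylorPoly_sum_close hn hN (x := x) hh hδ0 hε'0.le hreg.1
    fun k hk => hmom k (Finset.mem_range.2 hk)
  obtain ⟨hMs, hMle⟩ := hsumM (h⁻¹ • x)
  have hMs' := hMs.mul_left (A * (n ^ N * supGrad N u) * h ^ N)
  have hs2 : Summable fun j => lam h j (xt j) (st j) (fun y => u y - taylorPoly N u x y) *
      η (δ • (h⁻¹ • x - intPt j)) := Summable.of_norm_bounded hMs' hrem
  have hremsum : ‖∑' j, lam h j (xt j) (st j) (fun y => u y - taylorPoly N u x y) *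
      η (δ • (h⁻¹ • x - intPt j))‖ ≤ A * (n ^ N * supGrad N u) * h ^ N * M := by
    refine (tsum_of_norm_bounded hMs'.hasSum hrem).trans ?_
    rw [tsum_mul_left]
    gcongr
  have hsplit : summand η (δ ^ 2)⁻¹ h xt st u x = fun j =>
      taylorPoly N u x (h • intPt j) * η (δ • (h⁻¹ • x - intPt j)) +
      lam h j (xt j) (st j) (fun y => u y - taylorPoly N u x y) *
        η (δ • (h⁻¹ • x - intPt j)) := by
    ext1 j
    have h1 : (h * Real.sqrt ((δ ^ 2)⁻¹))⁻¹ • (x - h • intPt j) = δ • (h⁻¹ • x - intPt j) := by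
      rw [hsqrt, mul_inv, inv_inv, smul_sub, smul_sub, smul_smul, smul_smul, mul_comm h⁻¹ δ,
        mul_assoc, inv_mul_cancel₀ hh.ne', mul_one]
    rw [summand, h1, ← add_mul, ← lam_taylorPoly hh.ne' j (xt j) (st j) (hdet j), ← lam_add]
    simp only [add_sub_cancel]
  refine ⟨by rw [hsplit]; exact hs1.add hs2, ?_⟩
  rw [quasi, hDn, hsplit, hs1.tsum_add hs2, smul_add, hsqrt, add_sub_right_comm]
  refine (norm_add_le _ _).trans ?_
  rw [add_comm]
  refine add_le_add ?_ (hclose.trans_eq ?_)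
  · rw [norm_smul, Real.norm_eq_abs, abs_of_pos (by positivity)]
    calc _ ≤ δ ^ n * (A * (n ^ N * supGrad N u) * h ^ N * M) := by gcongr
      _ = _ := by ring
  · rw [hε', mul_div_cancel₀ _ hnN.ne']
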